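/- **Setting.** Let $I$ be a set with a countably incomplete ultrafilter $\mathcal U$ (there are $A_0,A_1,\dots\in\mathcal U$ with $\bigcap_n A_n=\varnothing$), and for a set $S$ let ${}^*S=S^I/\mathcal U$ be its ultrapower; functions, relations and operations on $S$ are extended to ${}^*S$ componentwise. Fix $d\in\mathbb N_0$. For an open set $\Omega\subseteq\mathbb R^d$ let $\mathcal E(\Omega)=C^\infty(\Omega,\mathbb C)$, let $\mathcal D(\Omega)$ be the space of test functions and $\mathcal D'(\Omega)$ the space of Schwartz distributions on $\Omega$; for $f\in\mathcal E(\Omega)$ let $T_f\in\mathcal D'(\Omega)$, $\langle T_f,\varphi\rangle=\int_\Omega f\varphi\,dx$. Elements of ${}^*\mathcal E(\Omega)$ and ${}^*\mathcal D(\Omega)$ are regarded as functions ${}^*\Omega\to{}^*\mathbb C$, and ${}^*f\in{}^*\mathcal E(\Omega)$ is the class of the constant family $f$. Let $\mu(\Omega)\subseteq{}^*\Omega$ be the set of points that are infinitely close to a (standard) point of $\Omega$. Let $\rho\in{}^*\mathbb R$ be a positive infinitesimal. A number $z\in{}^*\mathbb C$ is *$\rho$-moderate* if $|z|\le\rho^{-n}$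 for some $n\in\mathbb N$, and *$\rho$-negligible* if $|z|\le\rho^n$ for all $n\in\mathbb N$. A function $f\in{}^*\mathcal E(\Omega)$ is $\rho$-moderate (resp. $\rho$-negligible) if for all $\alpha\in\mathbb N_0^d$ and all $x\in\mu(\Omega)$ the number $\partial^\alpha f(x)$ is $\rho$-moderate (resp. $\rho$-negligible). The $\rho$-moderate functions form a subalgebra of ${}^*\mathcal E(\Omega)$ in which the $\rho$-negligible ones form an ideal; the quotient algebra ${}^\rho\mathcal E(\Omega)$ is the algebra of *$\rho$-asymptotic functions*, and $\widehat f$ denotes the class of $f$. Partial derivatives and restrictions to open subsets are defined on representatives. A function $D\in{}^*\mathcal E(\mathbb R^d)$ is a *$\rho$-delta function* if $D(x)=0$ for $\|x\|\ge\rho$; $\int_{\|x\|\le\rho}D(x)\,dx-1$ is $\rho$-negligible; $\int_{\|x\|\le\rho}D(x)\,x^\alpha dx$ is $\rho$-negligible for all $\alpha\in\mathbb N_0^d$, $\alpha\ne0$; and $D$ is $\rho$-moderate. A function $\Pi\in{}^*\mathcal D(\Omega)$ is a *$\rho$-cut-off function* for $\Omega$ if $\Pi(x)=1$ for all $x\in\mu(\Omega)$,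 and $\|x-y\|\ge\rho$ for all $x$ in the (internal) support of $\Pi$ and all $y\in{}^*(\partial\Omega)$. **Theorem (Existence of an Embedding).** For every positive infinitesimal $\rho$ there are a $\rho$-delta function $D$, for each open $\Omega\subseteq\mathbb R^d$ a $\rho$-cut-off function $\Pi_\Omega$ for $\Omega$, and for each open $\Omega\subseteq\mathbb R^d$ a $\mathbb C$-linear map $\Sigma_\Omega:\mathcal D'(\Omega)\to{}^\rho\mathcal E(\Omega)$, such that for all open $\Omega\subseteq\mathbb R^d$: 1. for every $T\in\mathcal D'(\Omega)$, $\Sigma_\Omega(T)$ is the class of the convolution $({}^*T\,\Pi_\Omega)\star D$, i.e. of the $\rho$-moderate function in ${}^*\mathcal E(\Omega)$ given by $x\mapsto\langle{}^*T,\ \xi\mapsto\Pi_\Omega(\xi)D(x-\xi)\rangle$ for $x\in{}^*\Omega$; 2. $f\mapsto T_f$, $\mathcal E(\Omega)\to\mathcal D'(\Omega)$, and $\Sigma_\Omega$ are injective; 3. $\Sigma_\Omega(\partial^\alpha T)=\partial^\alpha\Sigma_\Omega(T)$ for all $T\in\mathcal D'(\Omega)$ and $\alpha\in\mathbb N_0^d$;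 4. $\Sigma$ preserves the sheaf structure: for every open $O\subseteq\Omega$ and $T\in\mathcal D'(\Omega)$, $\Sigma_O(T|_O)=\Sigma_\Omega(T)|_O$, and $\Sigma_\Omega(T)|_O=0$ if and only if $T|_O=0$; 5. $\Sigma_\Omega(T_f)=\widehat{{}^*f}$ for every $f\in\mathcal E(\Omega)$; 6. consequently $\Sigma_\Omega(T_f)\,\Sigma_\Omega(T_g)=\Sigma_\Omega(T_{fg})$ for all $f,g\in\mathcal E(\Omega)$: the multiplication of ${}^\rho\mathcal E(\Omega)$ extends the pointwise multiplication of $\mathcal E(\Omega)$. In short, $\mathcal E(\Omega)\hookrightarrow\mathcal D'(\Omega)\hookrightarrow{}^\rho\mathcal E(\Omega)$. -/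

import Mathlib

open scoped ContDiff Distributions
open TopologicalSpace Filter

namespace RhoAsymptotic

noncomputable section

/-! ### Iterated partial derivatives -/

/-- `∂^α = ∂₁^{α₁} ⋯ ∂_d^{α_d}` for a family `∂₁, …, ∂_d` of linear operators on a space `X`
(in all uses below, the operators of the family commute). -/
def multiDeriv {d : ℕ} {X : Type*} [AddCommGroup X] [Module ℂ X]
    (D : Fin d → Module.End ℂ X) (α : Fin d → ℕ) : Module.End ℂ X :=
  ((List.finRange d).map fun j => D j ^ α j).prod

theorem multiDeriv_zero {d : ℕ} {X : Type*} [AddCommGroup X] [Module ℂ X]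
    (D : Fin d → Module.End ℂ X) : multiDeriv D 0 = 1 := by
  simp [multiDeriv]

theorem list_prod_add_single {d : ℕ} {X : Type*} [AddCommGroup X] [Module ℂ X]
    (D : Fin d → Module.End ℂ X) (hD : ∀ i j, Commute (D i) (D j)) (α : Fin d → ℕ) (j : Fin d)
    (l : List (Fin d)) (hl : l.Nodup) :
    (l.map fun i => D i ^ (α + Pi.single j 1 : Fin d → ℕ) i).prod =
      if j ∈ l then D j * (l.map fun i => D i ^ α i).prod
      else (l.map fun i => D i ^ α i).prod := by
  induction l with
  | nil => simp
  | cons i l ih =>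
    have hn := List.nodup_cons.1 hl
    rw [List.map_cons, List.prod_cons, ih hn.2, List.map_cons, List.prod_cons]
    by_cases hij : i = j
    · subst hij
      simp [hn.1, pow_succ', mul_assoc]
    · have hji : ¬ j = i := fun h => hij h.symm
      have h0 : (α + Pi.single j 1 : Fin d → ℕ) i = α i := by simp [hij]
      rw [h0]
      by_cases hjl : j ∈ l
      · simp only [hjl, if_true, List.mem_cons, or_true]
        rw [← mul_assoc, ((hD i j).pow_left (α i)).eq, mul_assoc]
      · simp [hjl, hji]

theorem multiDeriv_add_single {d : ℕ} {X : Type*} [AddCommGroup X] [Module ℂ X]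
    (D : Fin d → Module.End ℂ X) (hD : ∀ i j, Commute (D i) (D j)) (α : Fin d → ℕ) (j : Fin d) :
    multiDeriv D (α + Pi.single j 1) = D j * multiDeriv D α := by
  unfold multiDeriv
  rw [list_prod_add_single D hD α j _ (List.nodup_finRange d)]
  simp

theorem commute_multiDeriv {d : ℕ} {X : Type*} [AddCommGroup X] [Module ℂ X]
    (D : Fin d → Module.End ℂ X) (hD : ∀ i j, Commute (D i) (D j)) (α : Fin d → ℕ) (j : Fin d) :
    Commute (D j) (multiDeriv D α) := by
  refine Commute.list_prod_right _ _ fun x hx => ?_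
  obtain ⟨i, -, rfl⟩ := List.mem_map.1 hx
  exact (hD j i).pow_right _

theorem map_multiDeriv {d : ℕ} {X Y : Type*} [AddCommGroup X] [Module ℂ X]
    [AddCommGroup Y] [Module ℂ Y] (D : Fin d → Module.End ℂ X) (D' : Fin d → Module.End ℂ Y)
    (φ : X →ₗ[ℂ] Y) (h : ∀ j f, φ (D j f) = D' j (φ f)) (α : Fin d → ℕ) (f : X) :
    φ (multiDeriv D α f) = multiDeriv D' α (φ f) := by
  have hp : ∀ j (n : ℕ) (f : X), φ ((D j ^ n) f) = (D' j ^ n) (φ f) := by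
    intro j n
    induction n with
    | zero => simp
    | succ n ih => intro f; rw [pow_succ, pow_succ, Module.End.mul_apply, ih, h]; rfl
  unfold multiDeriv
  induction List.finRange d generalizing f with
  | nil => simp
  | cons i l ih => simp [hp, ih]

/-- Every multi-index is reached from `0` by adding unit multi-indices. -/
theorem multiIndex_induction {d : ℕ} {P : (Fin d → ℕ) → Prop} (h0 : P 0)
    (hs : ∀ α j, P α → P (α + Pi.single j 1)) (α : Fin d → ℕ) : P α := by
  induction hn : ∑ i, α i generalizing α with
  | zero =>
    have : α = 0 := by
      ext i
      simpa using (Finset.sum_eq_zero_iff.1 hn) i (Finset.mem_univ i)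
    exact this ▸ h0
  | succ n ih =>
    obtain ⟨j, -, hj⟩ : ∃ j ∈ Finset.univ, α j ≠ 0 := by
      by_contra! hc
      rw [Finset.sum_eq_zero hc] at hn
      omega
    have hα : (α - Pi.single j 1) + Pi.single j 1 = α := by
      ext i
      by_cases hij : i = j
      · subst hij
        simp only [Pi.add_apply, Pi.sub_apply, Pi.single_eq_same]
        omega
      · simp [hij]
    rw [← hα]
    refine hs _ j (ih _ ?_)
    have h1 : ∑ i, ((α - Pi.single j 1) + Pi.single j 1 : Fin d → ℕ) i = n + 1 := by
      rw [hα]; exact hn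
    simp only [Pi.add_apply] at h1
    rw [Finset.sum_add_distrib] at h1
    simp only [Finset.sum_pi_single', Finset.mem_univ, if_true] at h1
    exact Nat.succ_injective h1

/-! ### Smooth functions on an open set -/

/-- The Euclidean space `ℝ^d`. -/
abbrev Vec (d : ℕ) := EuclideanSpace ℝ (Fin d)

/-- The `j`-th standard unit vector of `ℝ^d`. -/
def unitVec {d : ℕ} (j : Fin d) : Vec d := EuclideanSpace.single j 1

/-- Extension by `0` of a function on `Ω` to all of `ℝ^d`. -/
def extZero {d : ℕ} {Ω : Opens (Vec d)} (f : Ω → ℂ) : Vec d → ℂ :=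
  Function.extend Subtype.val f 0

theorem extZero_coe {d : ℕ} {Ω : Opens (Vec d)} (f : Ω → ℂ) (x : Ω) : extZero f x = f x :=
  Subtype.val_injective.extend_apply f 0 x

theorem extZero_mem {d : ℕ} {Ω : Opens (Vec d)} (f : Ω → ℂ) {x : Vec d} (hx : x ∈ Ω) :
    extZero f x = f ⟨x, hx⟩ := extZero_coe f ⟨x, hx⟩

/-- The algebra `E(Ω) = C^∞(Ω)` of the smooth functions `Ω → ℂ`. -/
def Smooth {d : ℕ} (Ω : Opens (Vec d)) : Subalgebra ℂ (Ω → ℂ) where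
  carrier := {f | ContDiffOn ℝ ∞ (extZero f) Ω}
  mul_mem' {f g} hf hg := by
    refine (ContDiffOn.mul hf hg).congr fun x hx => ?_
    simp [extZero_mem _ hx]
  add_mem' {f g} hf hg := by
    refine (ContDiffOn.add hf hg).congr fun x hx => ?_
    simp [extZero_mem _ hx]
  algebraMap_mem' c := by
    refine (contDiffOn_const (c := c)).congr fun x hx => ?_
    simp [extZero_mem _ hx]

theorem Smooth.contDiffAt {d : ℕ} {Ω : Opens (Vec d)} (f : Smooth Ω) {x : Vec d} (hx : x ∈ Ω) :
    ContDiffAt ℝ ∞ (extZero f.1) x :=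
  (f.2 : ContDiffOn ℝ ∞ (extZero f.1) Ω).contDiffAt (Ω.isOpen.mem_nhds hx)

theorem Smooth.differentiableAt {d : ℕ} {Ω : Opens (Vec d)} (f : Smooth Ω) {x : Vec d}
    (hx : x ∈ Ω) : DifferentiableAt ℝ (extZero f.1) x :=
  (Smooth.contDiffAt f hx).differentiableAt (by simp)

theorem extZero_eventuallyEq {d : ℕ} {Ω : Opens (Vec d)} (f : Ω → ℂ) (g : Vec d → ℂ)
    (h : ∀ x : Ω, f x = g x) {x : Vec d} (hx : x ∈ Ω) : extZero f =ᶠ[nhds x] g := by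
  filter_upwards [Ω.isOpen.mem_nhds hx] with y hy
  rw [extZero_mem f hy, h]

/-- The partial derivative `∂_j` on `E(Ω)`. -/
def Smooth.pderiv {d : ℕ} {Ω : Opens (Vec d)} (j : Fin d) : Module.End ℂ (Smooth Ω) where
  toFun f := ⟨fun x => fderiv ℝ (extZero f.1) x (unitVec j), by
    have h1 : ContDiffOn ℝ ∞ (fun x => fderiv ℝ (extZero f.1) x (unitVec j)) Ω :=
      (ContDiffOn.fderiv_of_isOpen f.2 Ω.isOpen (by simp)).clm_apply contDiffOn_const
    refine h1.congr fun x hx => ?_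
    rw [extZero_mem _ hx]⟩
  map_add' f g := by
    ext x
    have h : extZero (f + g).1 =ᶠ[nhds x.1] extZero f.1 + extZero g.1 :=
      extZero_eventuallyEq _ _ (fun y => by simp [extZero_coe]) x.2
    simp only [h.fderiv_eq]
    rw [fderiv_add (Smooth.differentiableAt f x.2) (Smooth.differentiableAt g x.2)]
    rfl
  map_smul' c f := by
    ext x
    have h : extZero (c • f).1 =ᶠ[nhds x.1] c • extZero f.1 :=
      extZero_eventuallyEq _ _ (fun y => by simp [extZero_coe]) x.2
    simp only [h.fderiv_eq]
    rw [fderiv_const_smul (Smooth.differentiableAt f x.2)]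
    rfl

theorem Smooth.pderiv_apply {d : ℕ} {Ω : Opens (Vec d)} (j : Fin d) (f : Smooth Ω) (x : Ω) :
    (Smooth.pderiv j f).1 x = fderiv ℝ (extZero f.1) x (unitVec j) := rfl

theorem Smooth.pderiv_mul {d : ℕ} {Ω : Opens (Vec d)} (j : Fin d) (f g : Smooth Ω) :
    Smooth.pderiv j (f * g) = Smooth.pderiv j f * g + f * Smooth.pderiv j g := by
  ext x
  have h : extZero (f * g).1 =ᶠ[nhds x.1] extZero f.1 * extZero g.1 :=
    extZero_eventuallyEq _ _ (fun y => by simp [extZero_coe]) x.2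
  simp only [Smooth.pderiv_apply, h.fderiv_eq]
  rw [fderiv_mul (Smooth.differentiableAt f x.2) (Smooth.differentiableAt g x.2)]
  simp [extZero_coe, Smooth.pderiv_apply]
  ring

theorem Smooth.pderiv_algebraMap {d : ℕ} {Ω : Opens (Vec d)} (j : Fin d) (c : ℂ) :
    Smooth.pderiv j (algebraMap ℂ (Smooth Ω) c) = 0 := by
  ext x
  have h : extZero (algebraMap ℂ (Smooth Ω) c).1 =ᶠ[nhds x.1] fun _ => c :=
    extZero_eventuallyEq (algebraMap ℂ (Smooth Ω) c).1 _ (fun y => rfl) x.2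
  rw [Smooth.pderiv_apply, h.fderiv_eq]
  simp

theorem Smooth.pderiv_commute {d : ℕ} {Ω : Opens (Vec d)} (i j : Fin d) :
    Commute (Smooth.pderiv (Ω := Ω) i) (Smooth.pderiv j) := by
  have key : ∀ (i j : Fin d) (f : Smooth Ω) (x : Ω),
      (Smooth.pderiv i (Smooth.pderiv j f)).1 x =
        fderiv ℝ (fderiv ℝ (extZero f.1)) x (unitVec i) (unitVec j) := by
    intro i j f x
    have h : extZero (Smooth.pderiv j f).1 =ᶠ[nhds x.1] fun y => fderiv ℝ (extZero f.1) y (unitVec j) :=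
      extZero_eventuallyEq (Smooth.pderiv j f).1 _ (fun y => rfl) x.2
    rw [Smooth.pderiv_apply, Filter.EventuallyEq.fderiv_eq h]
    have hd : DifferentiableAt ℝ (fderiv ℝ (extZero f.1)) x :=
      ((Smooth.contDiffAt f x.2).fderiv_right (m := 1) (by norm_cast)).differentiableAt (by simp)
    rw [fderiv_clm_apply hd (differentiableAt_const _)]
    simp
  refine LinearMap.ext fun f => Subtype.ext (funext fun x => ?_)
  rw [Module.End.mul_apply, Module.End.mul_apply, key, key]
  have hs : IsSymmSndFDerivAt ℝ (extZero f.1) x :=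
    (Smooth.contDiffAt f x.2).isSymmSndFDerivAt (by simp; norm_cast)
  exact hs _ _

/-- The restriction `E(Ω) → E(O)` for open sets `O ⊆ Ω`. -/
def Smooth.restrict {d : ℕ} {O Ω : Opens (Vec d)} (h : O ≤ Ω) : Smooth Ω →ₐ[ℂ] Smooth O where
  toFun f := ⟨fun x => f.1 ⟨x.1, h x.2⟩, by
    refine ContDiffOn.congr ((f.2 : ContDiffOn ℝ ∞ (extZero f.1) Ω).mono h) fun x hx => ?_
    rw [extZero_mem _ hx, extZero_mem _ (h hx)]⟩
  map_one' := rfl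
  map_mul' _ _ := rfl
  map_zero' := rfl
  map_add' _ _ := rfl
  commutes' _ := rfl

theorem Smooth.extZero_restrict {d : ℕ} {O Ω : Opens (Vec d)} (h : O ≤ Ω) (f : Smooth Ω)
    {x : Vec d} (hx : x ∈ O) : extZero (Smooth.restrict h f).1 x = extZero f.1 x := by
  rw [extZero_mem _ hx, extZero_mem _ (h hx)]
  rfl

theorem Smooth.restrict_pderiv {d : ℕ} {O Ω : Opens (Vec d)} (h : O ≤ Ω) (j : Fin d)
    (f : Smooth Ω) :
    Smooth.restrict h (Smooth.pderiv j f) = Smooth.pderiv j (Smooth.restrict h f) := by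
  refine Subtype.ext (funext fun x => ?_)
  have he : extZero (Smooth.restrict h f).1 =ᶠ[nhds x.1] extZero f.1 :=
    extZero_eventuallyEq _ _ (fun y => (extZero_mem f.1 (h y.2)).symm) x.2
  rw [Smooth.pderiv_apply, he.fderiv_eq]
  rfl

/-! ### Schwartz distributions -/

/-- The space `D'(Ω)` of Schwartz distributions: the continuous `ℂ`-linear functionals on the
space `D(Ω)` of the complex-valued test functions. -/
abbrev Distr {d : ℕ} (Ω : Opens (Vec d)) := 𝓓(Ω, ℂ) →L[ℂ] ℂ

/-- `⟨∂_j T, φ⟩ = - ⟨T, ∂_j φ⟩`. -/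
def Distr.pderiv {d : ℕ} {Ω : Opens (Vec d)} (j : Fin d) : Module.End ℂ (Distr Ω) where
  toFun T := -(T ∘L (TestFunction.lineDerivCLM ℂ (unitVec j) : 𝓓(Ω, ℂ) →L[ℂ] 𝓓(Ω, ℂ)))
  map_add' S T := by ext φ; simp; ring
  map_smul' c T := by ext φ; simp

/-- The restriction `D'(Ω) → D'(O)` for open sets `O ⊆ Ω`: a test function on `O` is a test
function on `Ω`. -/
def Distr.restrict {d : ℕ} {O Ω : Opens (Vec d)} (_h : O ≤ Ω) (T : Distr Ω) : Distr O :=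
  T ∘L (TestFunction.monoCLM ℂ : 𝓓(O, ℂ) →L[ℂ] 𝓓(Ω, ℂ))

theorem Smooth.locallyIntegrableOn {d : ℕ} {Ω : Opens (Vec d)} (f : Smooth Ω) :
    MeasureTheory.LocallyIntegrableOn (extZero f.1) Ω MeasureTheory.volume :=
  ContinuousOn.locallyIntegrableOn (ContDiffOn.continuousOn f.2) Ω.isOpen.measurableSet

/-- `f ↦ T_f`, where `⟨T_f, φ⟩ = ∫_Ω f(x) φ(x) dx`. -/
def Distr.ofSmooth {d : ℕ} {Ω : Opens (Vec d)} : Smooth Ω →ₗ[ℂ] Distr Ω where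
  toFun f := TestFunction.integralAgainstBilinCLM (ContinuousLinearMap.mul ℂ ℂ)
    MeasureTheory.volume (extZero f.1)
  map_add' f g := by
    ext φ
    have h : (extZero (f + g).1) = extZero f.1 + extZero g.1 := by
      funext x
      by_cases hx : x ∈ Ω
      · simp [extZero_mem _ hx]
      · have h0 : ∀ u : Ω → ℂ, extZero u x = 0 := fun u =>
          Function.extend_apply' _ _ _ (by rintro ⟨y, rfl⟩; exact hx y.2)
        simp [h0]
    rw [add_apply, TestFunction.integralAgainstBilinCLM_eq_integral (Smooth.locallyIntegrableOn f),
      TestFunction.integralAgainstBilinCLM_eq_integral (Smooth.locallyIntegrableOn g),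
      TestFunction.integralAgainstBilinCLM_eq_integral (Smooth.locallyIntegrableOn (f + g)), h,
      ← MeasureTheory.integral_add
        (TestFunction.integrable_bilin _ (Smooth.locallyIntegrableOn f) φ)
        (TestFunction.integrable_bilin _ (Smooth.locallyIntegrableOn g) φ)]
    simp [mul_add]
  map_smul' c f := by
    ext φ
    have h : (extZero (c • f).1) = c • extZero f.1 := by
      funext x
      by_cases hx : x ∈ Ω
      · simp [extZero_mem _ hx]
      · have h0 : ∀ u : Ω → ℂ, extZero u x = 0 := fun u =>
          Function.extend_apply' _ _ _ (by rintro ⟨y, rfl⟩; exact hx y.2)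
        simp [h0]
    rw [smul_apply, TestFunction.integralAgainstBilinCLM_eq_integral (Smooth.locallyIntegrableOn f),
      TestFunction.integralAgainstBilinCLM_eq_integral (Smooth.locallyIntegrableOn (c • f)), h,
      RingHom.id_apply, ← MeasureTheory.integral_smul]
    simp only [ContinuousLinearMap.mul_apply', Pi.smul_apply, smul_eq_mul]
    congr 1
    funext x
    ring

theorem Distr.ofSmooth_apply {d : ℕ} {Ω : Opens (Vec d)} (f : Smooth Ω) (φ : 𝓓(Ω, ℂ)) :
    Distr.ofSmooth f φ = ∫ x in (Ω : Set (Vec d)), extZero f.1 x * φ x := by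
  have h : Distr.ofSmooth f φ = ∫ x, φ x * extZero f.1 x := by
    change TestFunction.integralAgainstBilinCLM _ _ _ φ = _
    rw [TestFunction.integralAgainstBilinCLM_eq_integral (Smooth.locallyIntegrableOn f)]
    rfl
  rw [h, MeasureTheory.setIntegral_eq_integral_of_forall_compl_eq_zero]
  · simp_rw [mul_comm]
  · intro x hx
    rw [show φ x = 0 from image_eq_zero_of_notMem_tsupport fun hm => hx (φ.tsupport_subset hm),
      mul_zero]

/-! ### The non-standard extension -/

/-- An ultrafilter is countably incomplete if some sequence of its members has an empty
intersection. -/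
def CountablyIncomplete {I : Type*} (U : Ultrafilter I) : Prop :=
  ∃ S : ℕ → Set I, (∀ n, S n ∈ U) ∧ ⋂ n, S n = ∅

/-- The non-standard extension `*S`: the ultrapower of `S` modulo the ultrafilter `U`. In particular
`*ℝ`, `*ℂ`, `*(ℝ^d) = (*ℝ)^d` and `*E(Ω)`. The coercion `↑s` of `s : S` is `*s`. -/
abbrev Star {I : Type*} (U : Ultrafilter I) (S : Type*) := Germ (U : Filter I) S

section NonStandard

variable {I : Type*} {U : Ultrafilter I} {d : ℕ}

/-- The algebra `*E(Ω)` of the non-standard smooth functions on `Ω`: the ultrapower of `E(Ω)`. -/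
def StarE (U : Ultrafilter I) (Ω : Opens (Vec d)) := Star U (Smooth Ω)

/-- The element `⟨f_i⟩` of `*E(Ω)`. -/
def StarE.of (U : Ultrafilter I) {Ω : Opens (Vec d)} (f : I → Smooth Ω) : StarE U Ω :=
  (f : Star U (Smooth Ω))

/-- The non-standard extension `*f` of `f ∈ E(Ω)`. -/
def StarE.standard (U : Ultrafilter I) {Ω : Opens (Vec d)} (f : Smooth Ω) : StarE U Ω :=
  StarE.of U fun _ => f

theorem StarE.of_surjective {Ω : Opens (Vec d)} (f : StarE U Ω) : ∃ g, StarE.of U g = f :=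
  Quotient.exists_rep f

theorem StarE.of_eq {Ω : Opens (Vec d)} {f g : I → Smooth Ω} :
    StarE.of U f = StarE.of U g ↔ ∀ᶠ i in (U : Filter I), f i = g i :=
  Germ.coe_eq

instance (U : Ultrafilter I) (Ω : Opens (Vec d)) : CommRing (StarE U Ω) :=
  inferInstanceAs (CommRing (Germ (U : Filter I) (Smooth Ω)))

instance (U : Ultrafilter I) (Ω : Opens (Vec d)) : Algebra ℂ (StarE U Ω) where
  smul c f := Germ.map (fun g : Smooth Ω => c • g) f
  algebraMap :=
    { toFun := fun c => StarE.standard U (algebraMap ℂ (Smooth Ω) c)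
      map_one' := StarE.of_eq.2 (.of_forall fun _ => map_one _)
      map_mul' := fun _ _ => StarE.of_eq.2 (.of_forall fun _ => map_mul _ _ _)
      map_zero' := StarE.of_eq.2 (.of_forall fun _ => map_zero _)
      map_add' := fun _ _ => StarE.of_eq.2 (.of_forall fun _ => map_add _ _ _) }
  commutes' _ _ := mul_comm _ _
  smul_def' c f := by
    obtain ⟨f, rfl⟩ := StarE.of_surjective f
    exact StarE.of_eq.2 (.of_forall fun i => Algebra.smul_def c (f i))

theorem StarE.of_add {Ω : Opens (Vec d)} (f g : I → Smooth Ω) :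
    StarE.of U f + StarE.of U g = StarE.of U (fun i => f i + g i) := rfl

theorem StarE.of_mul {Ω : Opens (Vec d)} (f g : I → Smooth Ω) :
    StarE.of U f * StarE.of U g = StarE.of U (fun i => f i * g i) := rfl

theorem StarE.smul_of {Ω : Opens (Vec d)} (c : ℂ) (f : I → Smooth Ω) :
    c • StarE.of U f = StarE.of U (fun i => c • f i) := rfl

theorem StarE.algebraMap_eq {Ω : Opens (Vec d)} (c : ℂ) :
    algebraMap ℂ (StarE U Ω) c = StarE.standard U (algebraMap ℂ (Smooth Ω) c) := rfl

/-- The norm (absolute value) `‖⟨x_i⟩‖ = ⟨‖x_i‖⟩` in `*ℝ`. -/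
def starNorm {E : Type*} [NormedAddCommGroup E] (x : Star U E) : Star U ℝ :=
  Germ.map (fun v : E => ‖v‖) x

/-- `‖x‖ < 1 / n` for all positive integers `n`. -/
def IsInfinitesimal {E : Type*} [NormedAddCommGroup E] (x : Star U E) : Prop :=
  ∀ n : ℕ, starNorm x < ((1 / ((n : ℝ) + 1) : ℝ) : Star U ℝ)

/-- The monad `μ(X) = {r + h : r ∈ X, h ≈ 0}` of a set `X ⊆ ℝ^d`. -/
def monad (U : Ultrafilter I) (X : Set (Vec d)) : Set (Star U (Vec d)) :=
  {x | ∃ r ∈ X, IsInfinitesimal (x - (r : Star U (Vec d)))}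

/-- The non-standard extension `*X` of a set `X ⊆ S`. -/
def starSet (U : Ultrafilter I) {S : Type*} (X : Set S) : Set (Star U S) :=
  {x | Germ.LiftPred (fun s => s ∈ X) x}

/-- The value `⟨f_i⟩(⟨x_i⟩) = ⟨f_i(x_i)⟩` of `f ∈ *E(Ω)` at `x ∈ *Ω`. -/
def eval {Ω : Opens (Vec d)} (f : StarE U Ω) (x : Star U (Vec d)) : Star U ℂ :=
  Germ.map₂ (fun (g : Smooth Ω) y => extZero g.1 y) f x

theorem mem_starSet_of_infinitesimal {x : Star U (Vec d)} {r : Vec d}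
    (hx : IsInfinitesimal (x - (r : Star U (Vec d)))) {W : Set (Vec d)} (hW : W ∈ nhds r) :
    x ∈ starSet U W := by
  obtain ⟨ε, hε, hb⟩ := Metric.mem_nhds_iff.1 hW
  obtain ⟨n, hn⟩ := exists_nat_one_div_lt hε
  have h := hx n
  induction x using Germ.inductionOn with | _ x =>
  have h' : ∀ᶠ i in (U : Filter I), ‖x i - r‖ < 1 / ((n : ℝ) + 1) := Germ.coe_lt.1 h
  refine Filter.Eventually.mono h' fun i hi => hb ?_
  rw [Metric.mem_ball, dist_eq_norm]
  exact hi.trans hn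

theorem monad_subset_starSet (Ω : Opens (Vec d)) : monad U (Ω : Set (Vec d)) ⊆ starSet U Ω :=
  fun _ ⟨_, hr, hx⟩ => mem_starSet_of_infinitesimal hx (Ω.isOpen.mem_nhds hr)

theorem monad_mono {X Y : Set (Vec d)} (h : X ⊆ Y) : monad U X ⊆ monad U Y :=
  fun _ ⟨r, hr, hx⟩ => ⟨r, h hr, hx⟩

theorem starNorm_add_le {E : Type*} [NormedAddCommGroup E] (x y : Star U E) :
    starNorm (x + y) ≤ starNorm x + starNorm y := by
  induction x using Germ.inductionOn with | _ x =>
  induction y using Germ.inductionOn with | _ y =>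
  exact Filter.Eventually.of_forall fun i => norm_add_le (x i) (y i)

theorem starNorm_mul (x y : Star U ℂ) : starNorm (x * y) = starNorm x * starNorm y := by
  induction x using Germ.inductionOn with | _ x =>
  induction y using Germ.inductionOn with | _ y =>
  exact Germ.coe_eq.2 (Filter.Eventually.of_forall fun i => norm_mul (x i) (y i))

theorem starNorm_nonneg {E : Type*} [NormedAddCommGroup E] (x : Star U E) :
    0 ≤ starNorm x := by
  induction x using Germ.inductionOn with | _ x =>
  exact Filter.Eventually.of_forall fun i => norm_nonneg (x i)

theorem eval_add {Ω : Opens (Vec d)} (f g : StarE U Ω) {x : Star U (Vec d)}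
    (hx : x ∈ starSet U Ω) : eval (f + g) x = eval f x + eval g x := by
  obtain ⟨f, rfl⟩ := StarE.of_surjective f
  obtain ⟨g, rfl⟩ := StarE.of_surjective g
  induction x using Germ.inductionOn with | _ x =>
  refine Germ.coe_eq.2 (Filter.Eventually.mono hx fun i hi => ?_)
  change extZero (f i + g i).1 (x i) = extZero (f i).1 (x i) + extZero (g i).1 (x i)
  simp [extZero_mem _ (show x i ∈ Ω from hi)]

theorem eval_mul {Ω : Opens (Vec d)} (f g : StarE U Ω) {x : Star U (Vec d)}
    (hx : x ∈ starSet U Ω) : eval (f * g) x = eval f x * eval g x := by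
  obtain ⟨f, rfl⟩ := StarE.of_surjective f
  obtain ⟨g, rfl⟩ := StarE.of_surjective g
  induction x using Germ.inductionOn with | _ x =>
  refine Germ.coe_eq.2 (Filter.Eventually.mono hx fun i hi => ?_)
  change extZero (f i * g i).1 (x i) = extZero (f i).1 (x i) * extZero (g i).1 (x i)
  simp [extZero_mem _ (show x i ∈ Ω from hi)]

theorem eval_const {Ω : Opens (Vec d)} (c : ℂ) {x : Star U (Vec d)}
    (hx : x ∈ starSet U Ω) :
    eval (StarE.standard U (algebraMap ℂ (Smooth Ω) c)) x = (c : Star U ℂ) := by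
  induction x using Germ.inductionOn with | _ x =>
  refine Germ.coe_eq.2 (Filter.Eventually.mono hx fun i hi => ?_)
  exact extZero_mem (algebraMap ℂ (Smooth Ω) c).1 (show x i ∈ Ω from hi)

theorem eval_zero {Ω : Opens (Vec d)} {x : Star U (Vec d)} (hx : x ∈ starSet U Ω) :
    eval (U := U) (0 : StarE U Ω) x = 0 := by
  have h := eval_add (0 : StarE U Ω) 0 hx
  rw [add_zero] at h
  exact left_eq_add.1 h

/-- The partial derivative `∂_j ⟨f_i⟩ = ⟨∂_j f_i⟩` on `*E(Ω)`. -/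
def starPderiv {Ω : Opens (Vec d)} (j : Fin d) : Module.End ℂ (StarE U Ω) where
  toFun := Germ.map (Smooth.pderiv j)
  map_add' f g := by
    obtain ⟨f, rfl⟩ := StarE.of_surjective f
    obtain ⟨g, rfl⟩ := StarE.of_surjective g
    exact Germ.coe_eq.2 (Filter.Eventually.of_forall fun i => map_add _ (f i) (g i))
  map_smul' c f := by
    obtain ⟨f, rfl⟩ := StarE.of_surjective f
    exact Germ.coe_eq.2 (Filter.Eventually.of_forall fun i => map_smul _ c (f i))

theorem starPderiv_commute {Ω : Opens (Vec d)} (i j : Fin d) :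
    Commute (starPderiv (U := U) (Ω := Ω) i) (starPderiv j) := by
  refine LinearMap.ext fun f => ?_
  obtain ⟨f, rfl⟩ := StarE.of_surjective f
  exact Germ.coe_eq.2 (Filter.Eventually.of_forall fun k =>
    LinearMap.congr_fun (Smooth.pderiv_commute i j).eq (f k))

theorem starPderiv_mul {Ω : Opens (Vec d)} (j : Fin d) (f g : StarE U Ω) :
    starPderiv j (f * g) = starPderiv j f * g + f * starPderiv j g := by
  obtain ⟨f, rfl⟩ := StarE.of_surjective f
  obtain ⟨g, rfl⟩ := StarE.of_surjective g
  exact Germ.coe_eq.2 (Filter.Eventually.of_forall fun i => Smooth.pderiv_mul j (f i) (g i))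

theorem starPderiv_algebraMap {Ω : Opens (Vec d)} (j : Fin d) (c : ℂ) :
    starPderiv j (algebraMap ℂ (StarE U Ω) c) = 0 := by
  rw [StarE.algebraMap_eq]
  exact Germ.coe_eq.2 (Filter.Eventually.of_forall fun _ => Smooth.pderiv_algebraMap j c)

/-- The restriction `*E(Ω) → *E(O)`, `⟨f_i⟩ ↦ ⟨f_i|O⟩`, for open sets `O ⊆ Ω`. -/
def starRestrict (U : Ultrafilter I) {O Ω : Opens (Vec d)} (h : O ≤ Ω) :
    StarE U Ω →ₐ[ℂ] StarE U O where
  toFun := Germ.map (Smooth.restrict h)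
  map_one' := rfl
  map_zero' := rfl
  map_mul' f g := by
    obtain ⟨f, rfl⟩ := StarE.of_surjective f
    obtain ⟨g, rfl⟩ := StarE.of_surjective g
    rfl
  map_add' f g := by
    obtain ⟨f, rfl⟩ := StarE.of_surjective f
    obtain ⟨g, rfl⟩ := StarE.of_surjective g
    rfl
  commutes' c := by
    rw [StarE.algebraMap_eq, StarE.algebraMap_eq]
    rfl

theorem eval_starRestrict {O Ω : Opens (Vec d)} (h : O ≤ Ω) (f : StarE U Ω)
    {x : Star U (Vec d)} (hx : x ∈ starSet U O) : eval (starRestrict U h f) x = eval f x := by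
  obtain ⟨f, rfl⟩ := StarE.of_surjective f
  induction x using Germ.inductionOn with | _ x =>
  exact Germ.coe_eq.2 (Filter.Eventually.mono hx fun i hi => Smooth.extZero_restrict h (f i) hi)

theorem starRestrict_starPderiv {O Ω : Opens (Vec d)} (h : O ≤ Ω) (j : Fin d)
    (f : StarE U Ω) :
    starRestrict U h (starPderiv j f) = starPderiv j (starRestrict U h f) := by
  obtain ⟨f, rfl⟩ := StarE.of_surjective f
  exact Germ.coe_eq.2 (Filter.Eventually.of_forall fun i => Smooth.restrict_pderiv h j (f i))

/-! ### Moderate and negligible numbers -/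

/-- The type of the positive infinitesimals of `*ℝ`. -/
def PosInfinitesimal (U : Ultrafilter I) : Type _ :=
  {ρ : Star U ℝ // 0 < ρ ∧ IsInfinitesimal ρ}

/-- The `ρ`-moderate numbers: `|z| ≤ ρ⁻ⁿ` for some `n`. -/
def ModerateNum (ρ : PosInfinitesimal U) : Set (Star U ℂ) :=
  {z | ∃ n : ℕ, starNorm z ≤ (ρ.1⁻¹) ^ n}

/-- The `ρ`-negligible numbers: `|z| ≤ ρⁿ` for all `n`. -/
def NegligibleNum (ρ : PosInfinitesimal U) : Set (Star U ℂ) :=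
  {z | ∀ n : ℕ, starNorm z ≤ ρ.1 ^ n}

theorem PosInfinitesimal.two_mul_le (ρ : PosInfinitesimal U) : 2 * ρ.1 ≤ 1 := by
  obtain ⟨ρ, h0, h⟩ := ρ
  have h1 := h 1
  change 2 * ρ ≤ 1
  clear h
  induction ρ using Germ.inductionOn with | _ r =>
  have h2 : ∀ᶠ i in (U : Filter I), ‖r i‖ < 1 / (((1 : ℕ) : ℝ) + 1) := Germ.coe_lt.1 h1
  refine Filter.Eventually.mono h2 fun i hi => ?_
  have := (le_abs_self (r i)).trans_lt hi
  change 2 * r i ≤ 1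
  norm_num at this
  linarith

theorem PosInfinitesimal.le_one (ρ : PosInfinitesimal U) : ρ.1 ≤ 1 := by
  have h1 := ρ.two_mul_le
  have h2 := ρ.2.1
  linarith

theorem PosInfinitesimal.two_le_inv (ρ : PosInfinitesimal U) : 2 ≤ ρ.1⁻¹ := by
  rw [← one_div, le_div_iff₀ ρ.2.1]
  exact ρ.two_mul_le

theorem ModerateNum.add {ρ : PosInfinitesimal U} {z w : Star U ℂ} (hz : z ∈ ModerateNum ρ)
    (hw : w ∈ ModerateNum ρ) : z + w ∈ ModerateNum ρ := by
  obtain ⟨n, hn⟩ := hz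
  obtain ⟨m, hm⟩ := hw
  have h2 := ρ.two_le_inv
  have h1 : 1 ≤ ρ.1⁻¹ := by linarith
  refine ⟨n + m + 1, (starNorm_add_le z w).trans ?_⟩
  have ha : ρ.1⁻¹ ^ n ≤ ρ.1⁻¹ ^ (n + m) := pow_le_pow_right₀ h1 (by omega)
  have hb : ρ.1⁻¹ ^ m ≤ ρ.1⁻¹ ^ (n + m) := pow_le_pow_right₀ h1 (by omega)
  have hc : 0 ≤ ρ.1⁻¹ ^ (n + m) := by positivity
  rw [pow_succ]
  nlinarith

theorem ModerateNum.mul {ρ : PosInfinitesimal U} {z w : Star U ℂ} (hz : z ∈ ModerateNum ρ)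
    (hw : w ∈ ModerateNum ρ) : z * w ∈ ModerateNum ρ := by
  obtain ⟨n, hn⟩ := hz
  obtain ⟨m, hm⟩ := hw
  refine ⟨n + m, ?_⟩
  rw [starNorm_mul, pow_add]
  exact mul_le_mul hn hm (starNorm_nonneg w) ((starNorm_nonneg z).trans hn)

theorem ModerateNum.const (ρ : PosInfinitesimal U) (c : ℂ) : (c : Star U ℂ) ∈ ModerateNum ρ := by
  obtain ⟨n, hn⟩ := pow_unbounded_of_one_lt ‖c‖ (one_lt_two (α := ℝ))
  refine ⟨n, le_trans ?_ (pow_le_pow_left₀ zero_le_two ρ.two_le_inv n)⟩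
  exact Filter.Eventually.of_forall fun _ => hn.le

theorem NegligibleNum.zero (ρ : PosInfinitesimal U) : (0 : Star U ℂ) ∈ NegligibleNum ρ := by
  intro n
  have h : starNorm (0 : Star U ℂ) = 0 :=
    Germ.coe_eq.2 (Filter.Eventually.of_forall fun _ => norm_zero)
  rw [h]
  exact pow_nonneg ρ.2.1.le n

theorem NegligibleNum.add {ρ : PosInfinitesimal U} {z w : Star U ℂ} (hz : z ∈ NegligibleNum ρ)
    (hw : w ∈ NegligibleNum ρ) : z + w ∈ NegligibleNum ρ := by
  intro n
  refine (starNorm_add_le z w).trans ?_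
  have h1 := hz (n + 1)
  have h2 := hw (n + 1)
  have h3 := ρ.two_mul_le
  have h4 : 0 ≤ ρ.1 ^ n := pow_nonneg ρ.2.1.le n
  rw [pow_succ] at h1 h2
  nlinarith

theorem NegligibleNum.mul {ρ : PosInfinitesimal U} {z w : Star U ℂ} (hz : z ∈ ModerateNum ρ)
    (hw : w ∈ NegligibleNum ρ) : z * w ∈ NegligibleNum ρ := by
  obtain ⟨m, hm⟩ := hz
  intro n
  rw [starNorm_mul]
  refine (mul_le_mul hm (hw (m + n)) (starNorm_nonneg w)
    ((starNorm_nonneg z).trans hm)).trans (le_of_eq ?_)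
  rw [pow_add, ← mul_assoc, ← mul_pow, inv_mul_cancel₀ ρ.2.1.ne', one_pow, one_mul]

theorem NegligibleNum.moderate {ρ : PosInfinitesimal U} {z : Star U ℂ}
    (hz : z ∈ NegligibleNum ρ) : z ∈ ModerateNum ρ :=
  ⟨0, by simpa using hz 0⟩

/-! ### The algebra of `ρ`-asymptotic functions -/

/-- The `ρ`-moderate functions: `f ∈ *E(Ω)` such that `∂^α f(x)` is a `ρ`-moderate number for all
multi-indices `α` and all `x ∈ μ(Ω)`. -/
def IsModerate (ρ : PosInfinitesimal U) {Ω : Opens (Vec d)} (f : StarE U Ω) : Prop :=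
  ∀ (α : Fin d → ℕ), ∀ x ∈ monad U (Ω : Set (Vec d)),
    eval (multiDeriv starPderiv α f) x ∈ ModerateNum ρ

/-- The `ρ`-negligible functions: `f ∈ *E(Ω)` such that `∂^α f(x)` is a `ρ`-negligible number for
all multi-indices `α` and all `x ∈ μ(Ω)`. -/
def IsNegligible (ρ : PosInfinitesimal U) {Ω : Opens (Vec d)} (f : StarE U Ω) : Prop :=
  ∀ (α : Fin d → ℕ), ∀ x ∈ monad U (Ω : Set (Vec d)),
    eval (multiDeriv starPderiv α f) x ∈ NegligibleNum ρ

theorem multiDeriv_starPderiv {Ω : Opens (Vec d)} (α : Fin d → ℕ) (j : Fin d)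
    (f : StarE U Ω) :
    multiDeriv starPderiv (α + Pi.single j 1) f = multiDeriv starPderiv α (starPderiv j f) := by
  rw [multiDeriv_add_single _ starPderiv_commute,
    (commute_multiDeriv _ starPderiv_commute α j).eq]
  rfl

theorem IsModerate.pderiv {ρ : PosInfinitesimal U} {Ω : Opens (Vec d)} {f : StarE U Ω}
    (hf : IsModerate ρ f) (j : Fin d) : IsModerate ρ (starPderiv j f) := by
  intro α x hx
  rw [← multiDeriv_starPderiv]
  exact hf _ x hx

theorem IsNegligible.pderiv {ρ : PosInfinitesimal U} {Ω : Opens (Vec d)} {f : StarE U Ω}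
    (hf : IsNegligible ρ f) (j : Fin d) : IsNegligible ρ (starPderiv j f) := by
  intro α x hx
  rw [← multiDeriv_starPderiv]
  exact hf _ x hx

theorem IsModerate.add {ρ : PosInfinitesimal U} {Ω : Opens (Vec d)} {f g : StarE U Ω}
    (hf : IsModerate ρ f) (hg : IsModerate ρ g) : IsModerate ρ (f + g) := by
  intro α x hx
  rw [map_add, eval_add _ _ (monad_subset_starSet Ω hx)]
  exact ModerateNum.add (hf α x hx) (hg α x hx)

theorem IsModerate.mul {ρ : PosInfinitesimal U} {Ω : Opens (Vec d)} {f g : StarE U Ω}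
    (hf : IsModerate ρ f) (hg : IsModerate ρ g) : IsModerate ρ (f * g) := by
  intro α x hx
  have hx' := monad_subset_starSet Ω hx
  induction α using multiIndex_induction generalizing f g with
  | h0 =>
    have h1 := hf 0 x hx
    have h2 := hg 0 x hx
    rw [multiDeriv_zero, Module.End.one_apply] at h1 h2 ⊢
    rw [eval_mul _ _ hx']
    exact ModerateNum.mul h1 h2
  | hs α j ih =>
    rw [multiDeriv_starPderiv, starPderiv_mul, map_add, eval_add _ _ hx']
    exact ModerateNum.add (ih (hf.pderiv j) hg) (ih hf (hg.pderiv j))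

theorem IsModerate.mul_negligible {ρ : PosInfinitesimal U} {Ω : Opens (Vec d)}
    {f g : StarE U Ω} (hf : IsModerate ρ f) (hg : IsNegligible ρ g) :
    IsNegligible ρ (f * g) := by
  intro α x hx
  have hx' := monad_subset_starSet Ω hx
  induction α using multiIndex_induction generalizing f g with
  | h0 =>
    have h1 := hf 0 x hx
    have h2 := hg 0 x hx
    rw [multiDeriv_zero, Module.End.one_apply] at h1 h2 ⊢
    rw [eval_mul _ _ hx']
    exact NegligibleNum.mul h1 h2
  | hs α j ih =>
    rw [multiDeriv_starPderiv, starPderiv_mul, map_add, eval_add _ _ hx']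
    exact NegligibleNum.add (ih (hf.pderiv j) hg) (ih hf (hg.pderiv j))

theorem isModerate_const (ρ : PosInfinitesimal U) {Ω : Opens (Vec d)} (c : ℂ) :
    IsModerate ρ (algebraMap ℂ (StarE U Ω) c) := by
  intro α x hx
  have hx' := monad_subset_starSet Ω hx
  induction α using multiIndex_induction with
  | h0 =>
    rw [multiDeriv_zero, Module.End.one_apply, StarE.algebraMap_eq, eval_const c hx']
    exact ModerateNum.const ρ c
  | hs α j ih =>
    rw [multiDeriv_starPderiv, starPderiv_algebraMap, map_zero, eval_zero hx']
    exact NegligibleNum.moderate (NegligibleNum.zero ρ)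

theorem IsModerate.restrict {ρ : PosInfinitesimal U} {O Ω : Opens (Vec d)} (h : O ≤ Ω)
    {f : StarE U Ω} (hf : IsModerate ρ f) : IsModerate ρ (starRestrict U h f) := by
  intro α x hx
  have e := map_multiDeriv starPderiv starPderiv (starRestrict U h).toLinearMap
    (starRestrict_starPderiv h) α f
  rw [AlgHom.toLinearMap_apply, AlgHom.toLinearMap_apply] at e
  rw [← e, eval_starRestrict h _ (monad_subset_starSet O hx)]
  exact hf α x (monad_mono h hx)

theorem IsNegligible.restrict {ρ : PosInfinitesimal U} {O Ω : Opens (Vec d)} (h : O ≤ Ω)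
    {f : StarE U Ω} (hf : IsNegligible ρ f) : IsNegligible ρ (starRestrict U h f) := by
  intro α x hx
  have e := map_multiDeriv starPderiv starPderiv (starRestrict U h).toLinearMap
    (starRestrict_starPderiv h) α f
  rw [AlgHom.toLinearMap_apply, AlgHom.toLinearMap_apply] at e
  rw [← e, eval_starRestrict h _ (monad_subset_starSet O hx)]
  exact hf α x (monad_mono h hx)

/-- The algebra `M_ρ(*E(Ω))` of the `ρ`-moderate functions. -/
def Moderate (ρ : PosInfinitesimal U) (Ω : Opens (Vec d)) :
    Subalgebra ℂ (StarE U Ω) where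
  carrier := {f | IsModerate ρ f}
  mul_mem' hf hg := IsModerate.mul hf hg
  add_mem' hf hg := IsModerate.add hf hg
  algebraMap_mem' c := isModerate_const ρ c

/-- The ideal `N_ρ(*E(Ω))` of the `ρ`-negligible functions in `M_ρ(*E(Ω))`. -/
def Negligible (ρ : PosInfinitesimal U) (Ω : Opens (Vec d)) : Ideal (Moderate ρ Ω) where
  carrier := {f | IsNegligible ρ f.1}
  add_mem' {f g} hf hg := by
    intro α x hx
    change eval (multiDeriv starPderiv α (f.1 + g.1)) x ∈ _
    rw [map_add, eval_add _ _ (monad_subset_starSet Ω hx)]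
    exact NegligibleNum.add (hf α x hx) (hg α x hx)
  zero_mem' := by
    intro α x hx
    change eval (multiDeriv starPderiv α 0) x ∈ _
    rw [map_zero, eval_zero (monad_subset_starSet Ω hx)]
    exact NegligibleNum.zero ρ
  smul_mem' f _ hg := IsModerate.mul_negligible f.2 hg

/-- The algebra `^ρE(Ω) = M_ρ(*E(Ω)) / N_ρ(*E(Ω))` of the `ρ`-asymptotic functions on `Ω`. -/
def RhoE (ρ : PosInfinitesimal U) (Ω : Opens (Vec d)) := Moderate ρ Ω ⧸ Negligible ρ Ω

instance (ρ : PosInfinitesimal U) (Ω : Opens (Vec d)) : CommRing (RhoE ρ Ω) :=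
  inferInstanceAs (CommRing (Moderate ρ Ω ⧸ Negligible ρ Ω))

instance (ρ : PosInfinitesimal U) (Ω : Opens (Vec d)) : Algebra ℂ (RhoE ρ Ω) :=
  inferInstanceAs (Algebra ℂ (Moderate ρ Ω ⧸ Negligible ρ Ω))

/-- The class `Q_Ω(f) ∈ ^ρE(Ω)` of a `ρ`-moderate function `f`. -/
def RhoE.mk (ρ : PosInfinitesimal U) {Ω : Opens (Vec d)} (f : StarE U Ω)
    (hf : IsModerate ρ f) : RhoE ρ Ω :=
  Ideal.Quotient.mk (Negligible ρ Ω) ⟨f, hf⟩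

theorem RhoE.mk_surjective {ρ : PosInfinitesimal U} {Ω : Opens (Vec d)} (q : RhoE ρ Ω) :
    ∃ (f : StarE U Ω) (hf : IsModerate ρ f), RhoE.mk ρ f hf = q := by
  obtain ⟨f, rfl⟩ := Ideal.Quotient.mk_surjective (I := Negligible ρ Ω) q
  exact ⟨f.1, f.2, rfl⟩

theorem RhoE.mk_eq_mk {ρ : PosInfinitesimal U} {Ω : Opens (Vec d)} {f g : StarE U Ω}
    {hf : IsModerate ρ f} {hg : IsModerate ρ g} :
    RhoE.mk ρ f hf = RhoE.mk ρ g hg ↔ IsNegligible ρ (f - g) :=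
  Ideal.Quotient.eq (I := Negligible ρ Ω)

theorem RhoE.mk_add {ρ : PosInfinitesimal U} {Ω : Opens (Vec d)} {f g : StarE U Ω}
    (hf : IsModerate ρ f) (hg : IsModerate ρ g) :
    RhoE.mk ρ f hf + RhoE.mk ρ g hg = RhoE.mk ρ (f + g) (hf.add hg) := rfl

theorem RhoE.mk_mul {ρ : PosInfinitesimal U} {Ω : Opens (Vec d)} {f g : StarE U Ω}
    (hf : IsModerate ρ f) (hg : IsModerate ρ g) :
    RhoE.mk ρ f hf * RhoE.mk ρ g hg = RhoE.mk ρ (f * g) (hf.mul hg) := rfl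

theorem RhoE.smul_mk {ρ : PosInfinitesimal U} {Ω : Opens (Vec d)} (c : ℂ) {f : StarE U Ω}
    (hf : IsModerate ρ f) :
    c • RhoE.mk ρ f hf = RhoE.mk ρ (c • f) ((Moderate ρ Ω).smul_mem hf c) := rfl

/-- The partial derivative `∂_j` on `^ρE(Ω)`, induced by the partial derivative on `*E(Ω)`. -/
def RhoE.pderiv {ρ : PosInfinitesimal U} {Ω : Opens (Vec d)} (j : Fin d) :
    Module.End ℂ (RhoE ρ Ω) where
  toFun := Quotient.lift
    (fun f : Moderate ρ Ω => RhoE.mk ρ (starPderiv j f.1) (IsModerate.pderiv f.2 j))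
    fun f g hfg => by
      have h : IsNegligible ρ (f.1 - g.1) := (Submodule.quotientRel_def _).1 hfg
      refine RhoE.mk_eq_mk.2 ?_
      rw [← map_sub]
      exact h.pderiv j
  map_add' p q := by
    obtain ⟨f, hf, rfl⟩ := RhoE.mk_surjective p
    obtain ⟨g, hg, rfl⟩ := RhoE.mk_surjective q
    refine (RhoE.mk_eq_mk (g := starPderiv j f + starPderiv j g)
      (hg := (hf.pderiv j).add (hg.pderiv j))).2 ?_
    change IsNegligible ρ (starPderiv j (f + g) - _)
    rw [map_add, sub_self]
    exact (Negligible ρ Ω).zero_mem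
  map_smul' c p := by
    obtain ⟨f, hf, rfl⟩ := RhoE.mk_surjective p
    refine (RhoE.mk_eq_mk (g := c • starPderiv j f)
      (hg := (Moderate ρ Ω).smul_mem (hf.pderiv j) c)).2 ?_
    change IsNegligible ρ (starPderiv j (c • f) - _)
    rw [map_smul, sub_self]
    exact (Negligible ρ Ω).zero_mem

/-- The restriction `^ρE(Ω) → ^ρE(O)` for open sets `O ⊆ Ω`, induced by the restriction of
non-standard smooth functions. -/
def RhoE.restrict (ρ : PosInfinitesimal U) {O Ω : Opens (Vec d)} (h : O ≤ Ω) :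
    RhoE ρ Ω →ₐ[ℂ] RhoE ρ O :=
  Ideal.quotientMapₐ (I := Negligible ρ Ω) (Negligible ρ O)
    (((starRestrict U h).comp (Moderate ρ Ω).val).codRestrict (Moderate ρ O)
      fun f => IsModerate.restrict h f.2)
    fun _ hf => IsNegligible.restrict h hf

theorem RhoE.pderiv_mk {ρ : PosInfinitesimal U} {Ω : Opens (Vec d)} (j : Fin d)
    (f : StarE U Ω) (hf : IsModerate ρ f) :
    RhoE.pderiv j (RhoE.mk ρ f hf) = RhoE.mk ρ (starPderiv j f) (hf.pderiv j) := rfl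

theorem RhoE.restrict_mk {ρ : PosInfinitesimal U} {O Ω : Opens (Vec d)} (h : O ≤ Ω)
    (f : StarE U Ω) (hf : IsModerate ρ f) :
    RhoE.restrict ρ h (RhoE.mk ρ f hf) = RhoE.mk ρ (starRestrict U h f) (hf.restrict h) := rfl

theorem isModerate_standard (ρ : PosInfinitesimal U) {Ω : Opens (Vec d)} (f : Smooth Ω) :
    IsModerate ρ (StarE.standard U f) := by
  intro α
  have e : multiDeriv starPderiv α (StarE.standard U f) =
      StarE.standard U (multiDeriv Smooth.pderiv α f) := by
    induction α using multiIndex_induction with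
    | h0 => simp only [multiDeriv_zero, Module.End.one_apply]
    | hs α j ih =>
      rw [multiDeriv_add_single _ starPderiv_commute,
        multiDeriv_add_single _ Smooth.pderiv_commute, Module.End.mul_apply, ih]
      rfl
  rw [e]
  generalize multiDeriv Smooth.pderiv α f = g
  rintro x ⟨r, hr, hx⟩
  obtain ⟨n, hn⟩ := pow_unbounded_of_one_lt ‖extZero g.1 r‖ (one_lt_two (α := ℝ))
  have hc : ContinuousAt (fun y => ‖extZero g.1 y‖) r :=
    (Smooth.differentiableAt g hr).continuousAt.norm
  have hm := mem_starSet_of_infinitesimal hx (hc.preimage_mem_nhds (Iio_mem_nhds hn))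
  refine ⟨n, le_trans ?_ (pow_le_pow_left₀ zero_le_two ρ.two_le_inv n)⟩
  induction x using Germ.inductionOn with | _ x =>
  exact Filter.Eventually.mono hm fun i hi => le_of_lt hi

/-- The embedding `E(Ω) → ^ρE(Ω)` which maps `f` to the class of `*f`. -/
def RhoE.ofSmooth (ρ : PosInfinitesimal U) {Ω : Opens (Vec d)} : Smooth Ω →ₐ[ℂ] RhoE ρ Ω where
  toFun f := RhoE.mk ρ (StarE.standard U f) (isModerate_standard ρ f)
  map_one' := rfl
  map_mul' _ _ := rfl
  map_zero' := rfl
  map_add' _ _ := rfl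
  commutes' c := congrArg (Ideal.Quotient.mk (Negligible ρ Ω))
    (Subtype.ext (StarE.algebraMap_eq (U := U) c).symm)

/-! ### `ρ`-delta functions, `ρ`-cut-off functions and regularization -/

/-- `D ∈ *E(ℝ^d)` is a `ρ`-delta function: `D(x) = 0` for `‖x‖ ≥ ρ`, the integral of `D` over
`‖x‖ ≤ ρ` is `1` up to a `ρ`-negligible number, the moments of `D` of all orders `α ≠ 0` are
`ρ`-negligible numbers, and `D` is a `ρ`-moderate function. -/
structure IsRhoDelta (ρ : PosInfinitesimal U)
    (D : StarE U (⊤ : Opens (Vec d))) : Prop where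
  eq_zero : ∀ x : Star U (Vec d), ρ.1 ≤ starNorm x → eval D x = 0
  integral : Germ.map₂ (fun (f : Smooth (⊤ : Opens (Vec d))) (r : ℝ) =>
      ∫ x in Metric.closedBall (0 : Vec d) r, extZero f.1 x) D ρ.1 - 1 ∈ NegligibleNum ρ
  moment : ∀ α : Fin d → ℕ, α ≠ 0 → Germ.map₂ (fun (f : Smooth (⊤ : Opens (Vec d))) (r : ℝ) =>
      ∫ x in Metric.closedBall (0 : Vec d) r, extZero f.1 x * ∏ i, (x i : ℂ) ^ α i) D ρ.1
        ∈ NegligibleNum ρ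
  moderate : IsModerate ρ D

/-- `Π ∈ *D(Ω)` is a `ρ`-cut-off function for `Ω`: `Π(x) = 1` for all `x ∈ μ(Ω)`, and every point
of the (internal) support of `Π` has a distance of at least `ρ` to the boundary of `Ω`. -/
structure IsRhoCutoff (ρ : PosInfinitesimal U) {Ω : Opens (Vec d)}
    (P : Star U 𝓓(Ω, ℂ)) : Prop where
  eq_one : ∀ x ∈ monad U (Ω : Set (Vec d)),
    Germ.map₂ (fun (p : 𝓓(Ω, ℂ)) y => p y) P x = 1
  support : ∀ x : Star U (Vec d), Germ.LiftRel (fun (p : 𝓓(Ω, ℂ)) y => y ∈ tsupport p) P x →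
    ∀ y ∈ starSet U (frontier (Ω : Set (Vec d))), ρ.1 ≤ starNorm (x - y)

/-- The test function `ξ ↦ p(ξ) f(x - ξ)` on `Ω`. -/
def cutTranslate {Ω : Opens (Vec d)} (p : 𝓓(Ω, ℂ)) (f : Smooth (⊤ : Opens (Vec d)))
    (x : Vec d) : 𝓓(Ω, ℂ) where
  toFun ξ := p ξ * extZero f.1 (x - ξ)
  contDiff' := by
    have hf : ContDiff ℝ ∞ (extZero f.1) := by
      have h : ContDiffOn ℝ ∞ (extZero f.1) (⊤ : Opens (Vec d)) := f.2
      exact contDiffOn_univ.1 h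
    exact p.contDiff.mul (hf.comp (contDiff_const.sub contDiff_id))
  hasCompactSupport' := p.hasCompactSupport.mul_right
  tsupport_subset' := (tsupport_mul_subset_left).trans p.tsupport_subset

/-- `F ∈ *E(Ω)` is the convolution `(*T Π) ⋆ D`: for every `x ∈ *Ω`, the value `F(x)` is
`⟨*T, ξ ↦ Π(ξ) D(x - ξ)⟩`. Here `⟨*T, ⟨φ_i⟩⟩ = ⟨⟨T, φ_i⟩⟩`. -/
def IsConvolution {Ω : Opens (Vec d)} (T : Distr Ω) (P : Star U 𝓓(Ω, ℂ))
    (D : StarE U (⊤ : Opens (Vec d))) (F : StarE U Ω) : Prop :=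
  ∀ x ∈ starSet U (Ω : Set (Vec d)),
    eval F x = Germ.map T
      (Germ.map₂ (fun g y => g y) (Germ.map₂ (fun p f => cutTranslate p f) P D) x)

end NonStandard

end

end RhoAsymptotic

/-!
Averaging a bump function over the radii `r, r/2, …, r/(m+1)` with the weights of the polynomial
extrapolation to `0` gives a mollifier of radius `r` whose moments of the orders `1, …, m` vanish.
The weights do not depend on `r`, so `m` can tend to infinity as `r → 0` so slowly that the sum of
their absolute values stays below `r⁻¹`. These mollifiers, at `r = ρ`, form the delta function: the
seminorm estimates of a distribution `T` make `(*T Π) ⋆ D` moderate, and Taylor's formula, in which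
any prescribed number of terms is killed by the moments, shows that convolution with `D` moves a
smooth function only by a negligible amount.

Near every point of `μ(Ω)` the cut-off function is `1` on a ball of radius larger than `ρ`, so the
convolution does not see it there. Hence `T ↦ (*T Π) ⋆ D` commutes on `μ(Ω)` with derivatives and
restrictions; in particular all derivatives are moderate or negligible as soon as the values are,
for all `T`. Reflection of vanishing on open subsets is injectivity over the smaller set, because
the embedding commutes with restriction.

For injectivity, a negligible function is uniformly small on `*K` for each compact `K ⊆ Ω`, since
every point of `*K` lies in `μ(Ω)`. Hence its pairing with a test function is infinitesimal, while
the pairing of `(*T Π) ⋆ D` with `φ` is the convolution with `D` of the smooth function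
`y ↦ ⟨T, φ(· + y)⟩` at `0`, up to reflection, which is infinitely close to `⟨T, φ⟩`.
-/

namespace RhoAsymptotic

noncomputable section

open MeasureTheory
open scoped BoundedContinuousFunction

/-! ### Parametric derivatives and integrals -/

section PartialDeriv

variable {𝕜 X E V : Type*} [NontriviallyNormedField 𝕜] [NormedAddCommGroup X] [NormedSpace 𝕜 X]
  [NormedAddCommGroup E] [NormedSpace 𝕜 E] [NormedAddCommGroup V] [NormedSpace 𝕜 V] {u : X → E → V}

theorem contDiff_partial_fderiv (hu : ContDiff 𝕜 ∞ fun z : X × E => u z.1 z.2) :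
    ContDiff 𝕜 ∞ fun z : X × E => fderiv 𝕜 (u z.1) z.2 :=
  ContDiff.fderiv (f := fun z : X × E => u z.1) (m := ∞) (n := ∞)
    (hu.comp ((contDiff_fst.comp contDiff_fst).prodMk contDiff_snd)) contDiff_snd (by simp)

theorem contDiff_partial_iteratedFDeriv (hu : ContDiff 𝕜 ∞ fun z : X × E => u z.1 z.2) (k : ℕ) :
    ContDiff 𝕜 ∞ fun z : X × E => iteratedFDeriv 𝕜 k (u z.1) z.2 := by
  induction k with
  | zero =>
    simp only [iteratedFDeriv_zero_eq_comp]
    exact (continuousMultilinearCurryFin0 𝕜 E V).symm.contDiff.comp hu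
  | succ k ih =>
    simp only [iteratedFDeriv_succ_eq_comp_left]
    exact (continuousMultilinearCurryLeftEquiv 𝕜 (fun _ : Fin (k + 1) => E) V).symm.contDiff.comp
      (contDiff_partial_fderiv (u := fun x => iteratedFDeriv 𝕜 k (u x)) ih)

end PartialDeriv

section ParametricIntegral

variable {X E V : Type*} [NormedAddCommGroup X] [NormedSpace ℝ X] [MeasurableSpace X]
  [OpensMeasurableSpace X] [SecondCountableTopology X] {μ : Measure X} [IsLocallyFiniteMeasure μ]
  [NormedAddCommGroup E] [NormedSpace ℝ E] [FiniteDimensional ℝ E]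
  [NormedAddCommGroup V] [NormedSpace ℝ V] {u : X → E → V} {L : Set X}

theorem hasFDerivAt_setIntegral (hu : ContDiff ℝ ∞ fun z : X × E => u z.1 z.2) (hL : IsCompact L)
    (ξ : E) : HasFDerivAt (fun ξ => ∫ x in L, u x ξ ∂μ) (∫ x in L, fderiv ℝ (u x) ξ ∂μ) ξ := by
  have hc := (contDiff_partial_fderiv hu).continuous
  have huc := hu.continuous
  obtain ⟨M, hM⟩ := (hL.prod (isCompact_closedBall ξ 1)).bddAbove_image hc.norm.continuousOn
  refine hasFDerivAt_integral_of_dominated_of_fderiv_le (bound := fun _ => M)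
    (F' := fun ξ x => fderiv ℝ (u x) ξ) (Metric.closedBall_mem_nhds ξ one_pos) ?_ ?_ ?_ ?_ ?_ ?_
  · exact .of_forall fun ξ => Continuous.aestronglyMeasurable (by fun_prop)
  · exact ContinuousOn.integrableOn_compact' hL hL.isClosed.measurableSet
      (Continuous.continuousOn (by fun_prop))
  · exact (hc.comp (Continuous.prodMk_left ξ)).aestronglyMeasurable
  · refine (ae_restrict_iff' hL.isClosed.measurableSet).2 (.of_forall fun x hx ξ hξ => ?_)
    exact hM (Set.mem_image_of_mem _ (Set.mk_mem_prod hx hξ))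
  · exact integrableOn_const hL.measure_ne_top
  · have hux (x : X) : ContDiff ℝ ∞ (u x) := hu.comp (contDiff_prodMk_right x)
    exact .of_forall fun x y _ => ((hux x).differentiable (by simp)).differentiableAt.hasFDerivAt

variable [CompleteSpace V]

theorem iteratedFDeriv_setIntegral (hu : ContDiff ℝ ∞ fun z : X × E => u z.1 z.2)
    (hL : IsCompact L) (k : ℕ) (ξ : E) :
    iteratedFDeriv ℝ k (fun ξ => ∫ x in L, u x ξ ∂μ) ξ =
      ∫ x in L, iteratedFDeriv ℝ k (u x) ξ ∂μ := by
  induction k generalizing ξ with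
  | zero =>
    simp only [iteratedFDeriv_zero_eq_comp, Function.comp_apply]
    exact ((continuousMultilinearCurryFin0 ℝ E V).symm.toLinearIsometry.integral_comp_comm _).symm
  | succ k ih =>
    simp only [iteratedFDeriv_succ_eq_comp_left, Function.comp_apply]
    rw [funext ih,
      (hasFDerivAt_setIntegral (contDiff_partial_iteratedFDeriv hu k) hL ξ).fderiv]
    exact (ContinuousLinearEquiv.integral_comp_comm (𝕜 := ℝ) (μ := μ.restrict L)
      (E := E →L[ℝ] E [×k]→L[ℝ] V) (F := E [×(k + 1)]→L[ℝ] V)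
      (continuousMultilinearCurryLeftEquiv ℝ (fun _ : Fin (k + 1) => E) V).symm
      fun x => fderiv ℝ (iteratedFDeriv ℝ k (u x)) ξ).symm

theorem contDiff_setIntegral (hu : ContDiff ℝ ∞ fun z : X × E => u z.1 z.2) (hL : IsCompact L) :
    ContDiff ℝ ∞ fun ξ => ∫ x in L, u x ξ ∂μ := by
  refine contDiff_of_differentiable_iteratedFDeriv fun k _ => ?_
  simp_rw [funext (iteratedFDeriv_setIntegral hu hL k)]
  exact fun ξ => (hasFDerivAt_setIntegral (contDiff_partial_iteratedFDeriv hu k) hL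
    ξ).differentiableAt

end ParametricIntegral

/-! ### Distributions applied to smooth families of test functions -/

section Support

variable {E V : Type*} [TopologicalSpace E] [Zero V] {f : E → V} {K : Set E}

theorem tsupport_subset_of_forall_eq_zero (hK : IsClosed K) (h : ∀ ξ ∉ K, f ξ = 0) :
    tsupport f ⊆ K :=
  closure_minimal (Function.support_subset_iff'.2 h) hK

theorem eq_zero_of_tsupport_subset (h : tsupport f ⊆ K) {ξ : E} (hξ : ξ ∉ K) : f ξ = 0 :=
  image_eq_zero_of_notMem_tsupport fun hm => hξ (h hm)

end Support

theorem continuous_boundedContinuousFunction {X E V : Type*} [TopologicalSpace X]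
    [TopologicalSpace E] [PseudoMetricSpace V] [Zero V] {v : X → E →ᵇ V}
    (hv : Continuous fun z : X × E => v z.1 z.2) {K : Set E} (hK : IsCompact K)
    (hs : ∀ x, ∀ ξ ∉ K, v x ξ = 0) : Continuous v := by
  refine continuous_iff_continuousAt.2 fun x₀ => Metric.tendsto_nhds.2 fun ε hε => ?_
  have h : ∀ᶠ x in nhds x₀, ∀ ξ ∈ K, dist (v x ξ) (v x₀ ξ) < ε / 2 := by
    refine hK.eventually_forall_of_forall_eventually fun ξ _ => ?_
    have hc : Continuous fun z : X × E => dist (v z.1 z.2) (v x₀ z.2) :=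
      hv.dist ((v x₀).continuous.comp continuous_snd)
    exact hc.continuousAt.eventually_lt continuousAt_const (by simpa using half_pos hε)
  filter_upwards [h] with x hx
  refine lt_of_le_of_lt ((BoundedContinuousFunction.dist_le (half_pos hε).le).2 fun ξ => ?_)
    (half_lt_self hε)
  by_cases hξ : ξ ∈ K
  · exact (hx ξ hξ).le
  · rw [hs x ξ hξ, hs x₀ ξ hξ, dist_self]
    exact (half_pos hε).le

theorem exists_continuousLinearMap_comp_eq_of_norm_le {𝕜 M B : Type*} [RCLike 𝕜] [AddCommGroup M]
    [Module 𝕜 M] [NormedAddCommGroup B] [NormedSpace 𝕜 B] (J : M →ₗ[𝕜] B) (t : M →ₗ[𝕜] 𝕜) (C : ℝ)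
    (h : ∀ φ, ‖t φ‖ ≤ C * ‖J φ‖) : ∃ L : B →L[𝕜] 𝕜, ∀ φ, L (J φ) = t φ := by
  obtain ⟨L, hL, -⟩ := exists_extension_norm_eq (LinearMap.range J) (t.extendOfNorm J.rangeRestrict)
  exact ⟨L, fun φ => (hL (J.rangeRestrict φ)).trans
    (LinearMap.extendOfNorm_eq J.surjective_rangeRestrict.denseRange ⟨C, h⟩ φ)⟩

section Distribution

open ContDiffMapSupportedIn

variable {E : Type*} [NormedAddCommGroup E] [NormedSpace ℝ E] {Ω : Opens E} {K : Compacts E}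

/-- A test function with support in `K` as an element of `𝓓_{K}`, the space in which the
topology is given by seminorms. -/
def toSupportedIn (φ : 𝓓(Ω, ℂ)) (h : tsupport φ ⊆ K) : 𝓓_{K}(E, ℂ) :=
  .of_support_subset φ.contDiff ((subset_tsupport φ).trans h)

theorem exists_seminorm_bound (T : 𝓓(Ω, ℂ) →L[ℂ] ℂ) (hK : (K : Set E) ⊆ Ω) :
    ∃ (s : Finset ℕ) (C : ℝ), 0 ≤ C ∧ ∀ φ : 𝓓_{K}(E, ℂ), ‖T (TestFunction.ofSupportedIn hK φ)‖ ≤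
      C * s.sup (ContDiffMapSupportedIn.seminorm ℂ E ℂ ⊤ K) φ := by
  let T' : 𝓓_{K}(E, ℂ) →L[ℂ] ℂ := T ∘L TestFunction.ofSupportedInCLM ℂ hK
  obtain ⟨s, C, -, hC⟩ := Seminorm.bound_of_continuous
    (ContDiffMapSupportedIn.withSeminorms ℂ E ℂ ⊤ K) ((normSeminorm ℂ ℂ).comp T'.toLinearMap)
    T'.continuous.norm
  exact ⟨s, C, C.2, hC⟩

theorem exists_norm_apply_le (T : 𝓓(Ω, ℂ) →L[ℂ] ℂ) (hK : (K : Set E) ⊆ Ω) :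
    ∃ (N : ℕ) (C : ℝ), ∀ φ : 𝓓(Ω, ℂ), tsupport φ ⊆ K →
      ∀ M : ℝ, 0 ≤ M → (∀ k ≤ N, ∀ ξ, ‖iteratedFDeriv ℝ k φ ξ‖ ≤ M) → ‖T φ‖ ≤ C * M := by
  obtain ⟨s, C, hC, h⟩ := exists_seminorm_bound T hK
  refine ⟨s.sup id, C, fun φ hφ M hM hb => ?_⟩
  refine (h (toSupportedIn φ hφ)).trans (mul_le_mul_of_nonneg_left ?_ hC)
  refine Seminorm.finset_sup_apply_le hM fun k hk => ?_
  exact (ContDiffMapSupportedIn.seminorm_top_le_iff ℂ hM k _).2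
    fun ξ _ => hb k (Finset.le_sup (f := id) hk) ξ

/-- The Banach space in which the derivatives of orders `k ∈ s` of a test function live. It is a
definition, not an abbreviation, so that its norm is the only source of its topology. -/
def BoundedJets (E : Type*) [NormedAddCommGroup E] [NormedSpace ℝ E] (s : Finset ℕ) :=
  (k : s) → E →ᵇ (E [×k]→L[ℝ] ℂ)

namespace BoundedJets

variable {s : Finset ℕ}

instance : NormedAddCommGroup (BoundedJets E s) :=
  inferInstanceAs (NormedAddCommGroup ((k : s) → E →ᵇ (E [×k]→L[ℝ] ℂ)))

instance : NormedSpace ℂ (BoundedJets E s) :=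
  inferInstanceAs (NormedSpace ℂ ((k : s) → E →ᵇ (E [×k]→L[ℝ] ℂ)))

instance : CompleteSpace (BoundedJets E s) :=
  inferInstanceAs (CompleteSpace ((k : s) → E →ᵇ (E [×k]→L[ℝ] ℂ)))

/-- The derivatives of orders `k ∈ s` of a test function. -/
def ofTest (s : Finset ℕ) : 𝓓_{K}(E, ℂ) →L[ℂ] BoundedJets E s :=
  ContinuousLinearMap.pi fun k : s => structureMapCLM ℂ ⊤ k

/-- The value of the component of order `k` at the point `ξ`. -/
def eval (k : s) (ξ : E) : BoundedJets E s →L[ℝ] (E [×k]→L[ℝ] ℂ) :=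
  BoundedContinuousFunction.evalCLM ℝ ξ ∘L
    ContinuousLinearMap.proj (φ := fun k : s => E →ᵇ (E [×k]→L[ℝ] ℂ)) k

theorem eval_ofTest (φ : 𝓓_{K}(E, ℂ)) (k : s) (ξ : E) :
    eval k ξ (ofTest s φ) = iteratedFDeriv ℝ k φ ξ :=
  congrFun (structureMapCLM_top_apply ℂ φ) ξ

@[ext]
theorem ext {f g : BoundedJets E s} (h : ∀ k ξ, eval k ξ f = eval k ξ g) : f = g :=
  funext fun k => BoundedContinuousFunction.ext (h k)

theorem sup_seminorm_le_norm_ofTest (φ : 𝓓_{K}(E, ℂ)) :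
    s.sup (ContDiffMapSupportedIn.seminorm ℂ E ℂ ⊤ K) φ ≤ ‖ofTest s φ‖ :=
  Seminorm.finset_sup_apply_le (norm_nonneg _) fun k hk =>
    norm_le_pi_norm (fun k : s => structureMapCLM ℂ ⊤ k φ) ⟨k, hk⟩

end BoundedJets

/-- By Hahn–Banach, a distribution restricted to the test functions supported in `K` factors
through a Banach space of derivatives, where Bochner integrals are available. -/
theorem exists_comp_ofTest_eq (T : 𝓓(Ω, ℂ) →L[ℂ] ℂ) (hK : (K : Set E) ⊆ Ω) :
    ∃ (s : Finset ℕ) (L : BoundedJets E s →L[ℂ] ℂ), ∀ φ : 𝓓_{K}(E, ℂ),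
      L (BoundedJets.ofTest s φ) = T (TestFunction.ofSupportedIn hK φ) := by
  obtain ⟨s, C, hC, h⟩ := exists_seminorm_bound T hK
  obtain ⟨L, hL⟩ := exists_continuousLinearMap_comp_eq_of_norm_le
    (BoundedJets.ofTest (K := K) s).toLinearMap
    (T.toLinearMap ∘ₗ (TestFunction.ofSupportedInCLM ℂ hK).toLinearMap) C fun φ =>
      (h φ).trans (mul_le_mul_of_nonneg_left (BoundedJets.sup_seminorm_le_norm_ofTest φ) hC)
  exact ⟨s, L, hL⟩

variable {X Y : Type*} [NormedAddCommGroup X] [NormedSpace ℝ X] [NormedAddCommGroup Y]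
  [NormedSpace ℝ Y]

/-- A family of test functions on `Ω` depending smoothly on a parameter, with supports in a
common compact subset `K` of `Ω`. -/
structure IsSmoothFamily (u : X → 𝓓(Ω, ℂ)) (K : Compacts E) : Prop where
  contDiff : ContDiff ℝ ∞ fun z : X × E => u z.1 z.2
  subset : (K : Set E) ⊆ Ω
  tsupport_subset : ∀ x, tsupport (u x) ⊆ K

namespace IsSmoothFamily

variable {u : X → 𝓓(Ω, ℂ)}

theorem comp (hu : IsSmoothFamily u K) {c : Y → X} (hc : ContDiff ℝ ∞ c) :
    IsSmoothFamily (fun y => u (c y)) K :=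
  ⟨hu.contDiff.comp ((hc.comp contDiff_fst).prodMk contDiff_snd), hu.subset,
    fun y => hu.tsupport_subset (c y)⟩

theorem apply_eq_zero (hu : IsSmoothFamily u K) (x : X) {ξ : E} (hξ : ξ ∉ K) : u x ξ = 0 :=
  eq_zero_of_tsupport_subset (hu.tsupport_subset x) hξ

theorem contDiff_param (hu : IsSmoothFamily u K) (ξ : E) : ContDiff ℝ ∞ fun x => u x ξ :=
  hu.contDiff.comp (contDiff_prodMk_left ξ)

theorem smul (hu : IsSmoothFamily u K) {c : X → ℂ} (hc : ContDiff ℝ ∞ c) :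
    IsSmoothFamily (fun x => c x • u x) K where
  contDiff := (hc.comp contDiff_fst).mul hu.contDiff
  subset := hu.subset
  tsupport_subset x := tsupport_subset_of_forall_eq_zero K.isCompact.isClosed fun _ hξ =>
    mul_eq_zero_of_right _ (hu.apply_eq_zero x hξ)

theorem continuous_structureMap (hu : IsSmoothFamily u K) (k : ℕ) :
    Continuous fun x => structureMapCLM ℂ ⊤ k (toSupportedIn (u x) (hu.tsupport_subset x)) := by
  refine continuous_boundedContinuousFunction (K := K) ?_ K.isCompact fun x ξ hξ => ?_
  · simp only [structureMapCLM_top_apply]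
    exact (contDiff_partial_iteratedFDeriv (u := fun x => ⇑(u x)) hu.contDiff k).continuous
  · rw [structureMapCLM_top_apply]
    exact ContDiffMapSupportedIn.iteratedFDeriv_zero_on_compl _ hξ

theorem continuous_toSupportedIn (hu : IsSmoothFamily u K) :
    Continuous fun x => toSupportedIn (u x) (hu.tsupport_subset x) :=
  (ContDiffMapSupportedIn.continuous_iff_comp _).2 hu.continuous_structureMap

theorem continuous_apply (hu : IsSmoothFamily u K) (T : 𝓓(Ω, ℂ) →L[ℂ] ℂ) :
    Continuous fun x => T (u x) :=
  T.continuous.comp ((TestFunction.continuous_ofSupportedIn hu.subset).comp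
    hu.continuous_toSupportedIn)

theorem apply_setIntegral [MeasurableSpace X] [OpensMeasurableSpace X]
    [SecondCountableTopology X] [FiniteDimensional ℝ E] {μ : Measure X}
    [IsLocallyFiniteMeasure μ] (hu : IsSmoothFamily u K) (T : 𝓓(Ω, ℂ) →L[ℂ] ℂ) {L : Set X}
    (hL : IsCompact L) {w : 𝓓(Ω, ℂ)} (hw : ∀ ξ, w ξ = ∫ x in L, u x ξ ∂μ) :
    T w = ∫ x in L, T (u x) ∂μ := by
  have hwK : tsupport w ⊆ K :=
    tsupport_subset_of_forall_eq_zero K.isCompact.isClosed fun ξ hξ => by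
      simp [hw, hu.apply_eq_zero _ hξ]
  obtain ⟨s, Λ, hΛ⟩ := exists_comp_ofTest_eq T hu.subset
  let J (x : X) : BoundedJets E s := .ofTest s (toSupportedIn (u x) (hu.tsupport_subset x))
  have hJ : Integrable J (μ.restrict L) :=
    ContinuousOn.integrableOn_compact' hL hL.isClosed.measurableSet
      ((BoundedJets.ofTest s).continuous.comp hu.continuous_toSupportedIn).continuousOn
  have hJw : ∫ x in L, J x ∂μ = .ofTest s (toSupportedIn w hwK) := by
    ext1 k ξ
    have hw' : ⇑(toSupportedIn w hwK) = fun ξ => ∫ x in L, u x ξ ∂μ := funext hw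
    rw [BoundedJets.eval_ofTest, hw', iteratedFDeriv_setIntegral (u := fun x => u x) hu.contDiff hL,
      ← ContinuousLinearMap.integral_comp_comm _ hJ]
    simp only [J, BoundedJets.eval_ofTest]
    rfl
  calc T w = Λ (∫ x in L, J x ∂μ) := by rw [hJw]; exact (hΛ (toSupportedIn w hwK)).symm
    _ = ∫ x in L, Λ (J x) ∂μ := (Λ.integral_comp_comm hJ).symm
    _ = ∫ x in L, T (u x) ∂μ :=
      integral_congr_ae (.of_forall fun x => hΛ (toSupportedIn (u x) (hu.tsupport_subset x)))

theorem setIntegral_apply_congr [FiniteDimensional ℝ E] [MeasurableSpace X]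
    [OpensMeasurableSpace X] [SecondCountableTopology X] [MeasurableSpace Y]
    [OpensMeasurableSpace Y] [SecondCountableTopology Y] {μ : Measure X} {ν : Measure Y}
    [IsLocallyFiniteMeasure μ] [IsLocallyFiniteMeasure ν] {v : Y → 𝓓(Ω, ℂ)} {K' : Compacts E}
    (hu : IsSmoothFamily u K) (hv : IsSmoothFamily v K') (T : 𝓓(Ω, ℂ) →L[ℂ] ℂ) {L : Set X}
    {M : Set Y} (hL : IsCompact L) (hM : IsCompact M)
    (h : ∀ ξ, ∫ x in L, u x ξ ∂μ = ∫ y in M, v y ξ ∂ν) :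
    ∫ x in L, T (u x) ∂μ = ∫ y in M, T (v y) ∂ν := by
  have hsupp : tsupport (fun ξ => ∫ x in L, u x ξ ∂μ) ⊆ K :=
    tsupport_subset_of_forall_eq_zero K.isCompact.isClosed fun ξ hξ => by
      simp [hu.apply_eq_zero _ hξ]
  let w : 𝓓(Ω, ℂ) :=
    { toFun := fun ξ => ∫ x in L, u x ξ ∂μ
      contDiff' := contDiff_setIntegral (u := fun x => u x) hu.contDiff hL
      hasCompactSupport' := K.isCompact.of_isClosed_subset (isClosed_tsupport _) hsupp
      tsupport_subset' := hsupp.trans hu.subset }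
  exact (hu.apply_setIntegral T hL (w := w) fun _ => rfl).symm.trans
    (hv.apply_setIntegral T hM (w := w) h)

/-- The derivative of a smooth family of test functions at the parameter `x` in the direction `h`
of the parameter space, again a test function. -/
def dirDeriv (hu : IsSmoothFamily u K) (h x : X) : 𝓓(Ω, ℂ) :=
  have hts : tsupport (fun ξ => fderiv ℝ (fun y => u y ξ) x h) ⊆ K :=
    tsupport_subset_of_forall_eq_zero K.isCompact.isClosed fun ξ hξ => by
      simp [hu.apply_eq_zero _ hξ]
  { toFun := fun ξ => fderiv ℝ (fun y => u y ξ) x h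
    contDiff' := ((contDiff_partial_fderiv (u := fun ξ y => u y ξ)
      (hu.contDiff.comp (contDiff_snd.prodMk contDiff_fst))).comp
        (contDiff_id.prodMk contDiff_const)).clm_apply contDiff_const
    hasCompactSupport' := K.isCompact.of_isClosed_subset (isClosed_tsupport _) hts
    tsupport_subset' := hts.trans hu.subset }

theorem dirDeriv_apply (hu : IsSmoothFamily u K) (h x : X) (ξ : E) :
    hu.dirDeriv h x ξ = fderiv ℝ (fun y => u y ξ) x h := rfl

protected theorem isSmoothFamily_dirDeriv (hu : IsSmoothFamily u K) (h : X) :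
    IsSmoothFamily (hu.dirDeriv h) K where
  contDiff := ((contDiff_partial_fderiv (u := fun ξ y => u y ξ)
    (hu.contDiff.comp (contDiff_snd.prodMk contDiff_fst))).comp
      (contDiff_snd.prodMk contDiff_fst)).clm_apply contDiff_const
  subset := hu.subset
  tsupport_subset x := tsupport_subset_of_forall_eq_zero K.isCompact.isClosed fun ξ hξ => by
    simp [dirDeriv_apply, hu.apply_eq_zero _ hξ]

theorem apply_sub_eq_integral [FiniteDimensional ℝ E] (hu : IsSmoothFamily u K)
    (T : 𝓓(Ω, ℂ) →L[ℂ] ℂ) (x y : X) :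
    T (u y) - T (u x) =
      ∫ t in Set.Icc (0 : ℝ) 1, T (hu.dirDeriv (y - x) (x + t • (y - x))) := by
  let c (t : ℝ) : X := x + t • (y - x)
  have hc (t : ℝ) : HasDerivAt c (y - x) t := by
    simpa [c] using ((hasDerivAt_id t).smul_const (y - x)).const_add x
  have hu' := (hu.isSmoothFamily_dirDeriv (y - x)).comp (c := c)
    (contDiff_const.add (contDiff_id.smul contDiff_const))
  rw [← map_sub]
  refine hu'.apply_setIntegral T isCompact_Icc fun ξ => ?_
  rw [integral_Icc_eq_integral_Ioc, ← intervalIntegral.integral_of_le zero_le_one,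
    intervalIntegral.integral_eq_sub_of_hasDerivAt (f := fun t => u (c t) ξ) (fun t _ => ?_)
      ((hu'.contDiff_param ξ).continuous.intervalIntegrable _ _)]
  · simp [c]
  · exact ((hu.contDiff_param ξ).differentiable (by simp) _).hasFDerivAt.comp_hasDerivAt t (hc t)

section

variable [FiniteDimensional ℝ X]

/-- The derivative of `x ↦ T (u x)`, obtained by letting `T` act on the derivatives of `u`. -/
def applyFDeriv (hu : IsSmoothFamily u K) (T : 𝓓(Ω, ℂ) →L[ℂ] ℂ) (x : X) : X →L[ℝ] ℂ :=
  LinearMap.toContinuousLinearMap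
    { toFun := fun h => T (hu.dirDeriv h x)
      map_add' := fun h h' => by
        rw [← map_add]
        congr 1
        ext ξ
        simp [dirDeriv_apply]
      map_smul' := fun c h => by
        have e : hu.dirDeriv (c • h) x = (c : ℂ) • hu.dirDeriv h x := by
          ext ξ
          simp [dirDeriv_apply]
        simp [e] }

theorem applyFDeriv_apply (hu : IsSmoothFamily u K) (T : 𝓓(Ω, ℂ) →L[ℂ] ℂ) (x h : X) :
    hu.applyFDeriv T x h = T (hu.dirDeriv h x) := rfl

theorem continuous_applyFDeriv (hu : IsSmoothFamily u K) (T : 𝓓(Ω, ℂ) →L[ℂ] ℂ) :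
    Continuous (hu.applyFDeriv T) :=
  continuous_clm_apply.2 fun h => (hu.isSmoothFamily_dirDeriv h).continuous_apply T

variable [FiniteDimensional ℝ E]

theorem hasFDerivAt_apply (hu : IsSmoothFamily u K) (T : 𝓓(Ω, ℂ) →L[ℂ] ℂ) (x : X) :
    HasFDerivAt (fun x => T (u x)) (hu.applyFDeriv T x) x := by
  have hc := hu.continuous_applyFDeriv T
  refine HasFDerivAt.of_isLittleO (Asymptotics.isLittleO_iff.2 fun ε hε => ?_)
  obtain ⟨δ, hδ, hb⟩ := Metric.continuousAt_iff.1 (hc.continuousAt (x := x)) ε hε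
  filter_upwards [Metric.ball_mem_nhds x hδ] with y hy
  have hint : IntegrableOn (fun t : ℝ => hu.applyFDeriv T (x + t • (y - x)) (y - x))
      (Set.Icc 0 1) :=
    ((hc.comp (by fun_prop)).clm_apply continuous_const).integrableOn_Icc
  have hsub : T (u y) - T (u x) - hu.applyFDeriv T x (y - x) = ∫ t in Set.Icc (0 : ℝ) 1,
      (hu.applyFDeriv T (x + t • (y - x)) - hu.applyFDeriv T x) (y - x) := by
    simp only [sub_apply]
    rw [integral_sub hint (by simp), hu.apply_sub_eq_integral]
    simp [applyFDeriv_apply]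
  rw [hsub]
  refine (norm_setIntegral_le_of_norm_le_const (C := ε * ‖y - x‖) (by simp)
    fun t ht => ?_).trans (by simp)
  refine (ContinuousLinearMap.le_opNorm _ _).trans (mul_le_mul_of_nonneg_right ?_ (norm_nonneg _))
  rw [← dist_eq_norm]
  refine (hb ?_).le
  rw [dist_eq_norm, add_sub_cancel_left, norm_smul, Real.norm_of_nonneg ht.1]
  exact (mul_le_of_le_one_left (norm_nonneg _) ht.2).trans_lt (by rwa [← dist_eq_norm])

theorem contDiff_apply (hu : IsSmoothFamily u K) (T : 𝓓(Ω, ℂ) →L[ℂ] ℂ) :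
    ContDiff ℝ ∞ fun x => T (u x) := by
  refine contDiff_infty.2 fun n => ?_
  induction n generalizing u with
  | zero => exact contDiff_zero.2 (hu.continuous_apply T)
  | succ n ih =>
    exact contDiff_succ_iff_hasFDerivAt.2 ⟨_, contDiff_clm_apply_iff.2
      fun h => ih (hu.isSmoothFamily_dirDeriv h), hu.hasFDerivAt_apply T⟩

end

end IsSmoothFamily

end Distribution

/-! ### Extrapolation to zero -/

section Extrapolation

/-- The scales `1, 1/2, 1/3, …`, the nodes of the extrapolation to `0`. -/
def scale (k : ℕ) : ℝ := 1 / ((k : ℝ) + 1)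

theorem scale_pos (k : ℕ) : 0 < scale k := Nat.one_div_pos_of_nat

theorem scale_le_one (k : ℕ) : scale k ≤ 1 :=
  (div_le_one (by positivity)).2 (by simp)

theorem scale_injective : Function.Injective scale := fun i j h => by
  simpa [scale] using h

/-- The weights of the extrapolation to `0` from the values at the first `m + 1` scales: the
Lagrange basis polynomials evaluated at `0`. -/
def weight (m k : ℕ) : ℝ :=
  (Lagrange.basis (Finset.range (m + 1)) scale k).eval 0

/-- The sum of the absolute values of the extrapolation weights, which bounds the error of the
extrapolation. -/
def weightNorm (m : ℕ) : ℝ := ∑ k ∈ Finset.range (m + 1), |weight m k|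

theorem weightNorm_nonneg (m : ℕ) : 0 ≤ weightNorm m :=
  Finset.sum_nonneg fun _ _ => abs_nonneg _

theorem weightNorm_zero : weightNorm 0 = 1 := by
  simp [weightNorm, weight]

theorem sum_weight_mul_pow {m j : ℕ} (hj : j ≤ m) :
    ∑ k ∈ Finset.range (m + 1), weight m k * scale k ^ j = 0 ^ j := by
  have hdeg : (Polynomial.X ^ j : Polynomial ℝ).degree < (Finset.range (m + 1)).card := by
    rw [Polynomial.degree_X_pow, Finset.card_range]
    exact_mod_cast Nat.lt_succ_of_le hj
  have h := congrArg (Polynomial.eval 0)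
    (Lagrange.eq_interpolate (v := scale) scale_injective.injOn hdeg)
  simp only [Polynomial.eval_pow, Polynomial.eval_X, Lagrange.interpolate_apply,
    Polynomial.eval_finsetSum, Polynomial.eval_mul, Polynomial.eval_C] at h
  rw [h]
  exact Finset.sum_congr rfl fun k _ => mul_comm _ _

variable {E F V : Type*} [NormedAddCommGroup E] [NormedSpace ℝ E] [NormedAddCommGroup F]
  [NormedSpace ℝ F] [NormedAddCommGroup V] [NormedSpace ℝ V]

theorem norm_sum_weight_smul_le {m : ℕ} {v : ℕ → V} {B : ℝ} (hv : ∀ k, ‖v k‖ ≤ B) :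
    ‖∑ k ∈ Finset.range (m + 1), weight m k • v k‖ ≤ weightNorm m * B := by
  rw [weightNorm, Finset.sum_mul]
  refine norm_sum_le_of_le _ fun k _ => ?_
  rw [norm_smul, Real.norm_eq_abs]
  exact mul_le_mul_of_nonneg_left (hv k) (abs_nonneg _)

theorem sum_weight_smul_taylorWithinEval (h : ℝ → V) (s : Set ℝ) {m n : ℕ} (hn : n ≤ m) :
    ∑ k ∈ Finset.range (m + 1), weight m k • taylorWithinEval h n s 0 (scale k) = h 0 := by
  have hterm : ∀ j ∈ Finset.range (n + 1), ∑ k ∈ Finset.range (m + 1),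
      weight m k • ((j.factorial : ℝ)⁻¹ * (scale k - 0) ^ j) • iteratedDerivWithin j h s 0 =
        (0 ^ j * (j.factorial : ℝ)⁻¹) • iteratedDerivWithin j h s 0 := by
    intro j hj
    rw [← sum_weight_mul_pow ((Finset.mem_range_succ_iff.1 hj).trans hn), Finset.sum_mul,
      Finset.sum_smul]
    refine Finset.sum_congr rfl fun k _ => ?_
    rw [smul_smul, sub_zero]
    ring_nf
  simp only [taylor_within_apply, Finset.smul_sum]
  rw [Finset.sum_comm, Finset.sum_congr rfl hterm, Finset.sum_range_succ']
  simp

theorem norm_sub_taylorWithinEval_scale_le {h : ℝ → V} (hh : ContDiff ℝ ∞ h) {n : ℕ} {B : ℝ}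
    (hB : ∀ t ∈ Set.Icc (0 : ℝ) 1, ‖iteratedDeriv (n + 1) h t‖ ≤ B) (k : ℕ) :
    ‖h (scale k) - taylorWithinEval h n (Set.Icc 0 1) 0 (scale k)‖ ≤ B := by
  have hB0 : 0 ≤ B := (norm_nonneg _).trans (hB 0 (by simp))
  have hle : ((n + 1 : ℕ) : ℕ∞ω) ≤ ∞ := by exact_mod_cast le_top
  refine (taylor_mean_remainder_bound zero_le_one (hh.contDiffOn.of_le hle)
    ⟨(scale_pos k).le, scale_le_one k⟩ (C := B) fun t ht => ?_).trans ?_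
  · rw [iteratedDerivWithin_eq_iteratedDeriv (uniqueDiffOn_Icc zero_lt_one)
      (hh.contDiffAt.of_le hle) ht]
    exact hB t ht
  · rw [sub_zero]
    refine div_le_of_le_mul₀ (by positivity) hB0 (mul_le_mul_of_nonneg_left ?_ hB0)
    exact (pow_le_one₀ (scale_pos k).le (scale_le_one k)).trans (by exact_mod_cast n.factorial_pos)

theorem norm_sum_weight_smul_sub_le {h : ℝ → V} (hh : ContDiff ℝ ∞ h) {m n : ℕ} (hn : n ≤ m)
    {B : ℝ} (hB : ∀ t ∈ Set.Icc (0 : ℝ) 1, ‖iteratedDeriv (n + 1) h t‖ ≤ B) :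
    ‖∑ k ∈ Finset.range (m + 1), weight m k • h (scale k) - h 0‖ ≤ weightNorm m * B := by
  rw [← sum_weight_smul_taylorWithinEval h (Set.Icc 0 1) hn, ← Finset.sum_sub_distrib]
  simp_rw [← smul_sub]
  exact norm_sum_weight_smul_le (norm_sub_taylorWithinEval_scale_le hh hB)

theorem norm_iteratedFDeriv_comp_continuousLinearMap_le {g : F → V} (hg : ContDiff ℝ ∞ g)
    (A : E →L[ℝ] F) (j : ℕ) (x : E) :
    ‖iteratedFDeriv ℝ j (fun x => g (A x)) x‖ ≤ ‖iteratedFDeriv ℝ j g (A x)‖ * ‖A‖ ^ j := by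
  have h : iteratedFDeriv ℝ j (fun x => g (A x)) x = _ :=
    A.iteratedFDeriv_comp_right hg x (by exact_mod_cast le_top)
  rw [h]
  exact (ContinuousMultilinearMap.norm_compContinuousLinearMap_le _ _).trans (by simp)

theorem norm_sum_weight_smul_line_sub_le {g : E → V} (hg : ContDiff ℝ ∞ g) {m n : ℕ} (hn : n ≤ m)
    {C : ℝ} (x v : E) (hC : ∀ z ∈ Metric.closedBall x ‖v‖, ‖iteratedFDeriv ℝ (n + 1) g z‖ ≤ C) :
    ‖∑ k ∈ Finset.range (m + 1), weight m k • g (x + scale k • v) - g x‖ ≤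
      weightNorm m * (C * ‖v‖ ^ (n + 1)) := by
  have hline : ∀ t ∈ Set.Icc (0 : ℝ) 1,
      ‖iteratedDeriv (n + 1) (fun t : ℝ => g (x + t • v)) t‖ ≤ C * ‖v‖ ^ (n + 1) := by
    intro t ht
    have hg' : ContDiff ℝ ∞ fun z => g (x + z) := by fun_prop
    have hmem : x + t • v ∈ Metric.closedBall x ‖v‖ := by
      rw [Metric.mem_closedBall, dist_eq_norm, add_sub_cancel_left, norm_smul,
        Real.norm_of_nonneg ht.1]
      exact mul_le_of_le_one_left (norm_nonneg v) ht.2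
    rw [← norm_iteratedFDeriv_eq_norm_iteratedDeriv]
    refine (norm_iteratedFDeriv_comp_continuousLinearMap_le hg'
      (ContinuousLinearMap.toSpanSingleton ℝ v) (n + 1) t).trans ?_
    rw [ContinuousLinearMap.norm_toSpanSingleton, iteratedFDeriv_comp_add_left]
    gcongr
    exact hC _ hmem
  have hsmooth : ContDiff ℝ ∞ fun t : ℝ => g (x + t • v) := by fun_prop
  simpa using norm_sum_weight_smul_sub_le hsmooth hn hline

end Extrapolation

/-! ### Mollifiers with vanishing moments -/

section Mollifier

theorem exists_bound_iteratedFDeriv_of_hasCompactSupport {E V : Type*} [NormedAddCommGroup E]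
    [NormedSpace ℝ E] [NormedAddCommGroup V] [NormedSpace ℝ V] {g : E → V} (hg : ContDiff ℝ ∞ g)
    (hs : HasCompactSupport g) (j : ℕ) : ∃ C, ∀ x, ‖iteratedFDeriv ℝ j g x‖ ≤ C :=
  (hs.iteratedFDeriv (𝕜 := ℝ) j).exists_bound_of_continuous
    (hg.continuous_iteratedFDeriv (by exact_mod_cast le_top))

variable {d : ℕ}

/-- A smooth bump function with integral `1` and support in the unit ball. -/
def bump (d : ℕ) : Vec d → ℝ :=
  (⟨1 / 2, 1, by norm_num, by norm_num⟩ : ContDiffBump (0 : Vec d)).normed volume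

theorem contDiff_bump : ContDiff ℝ ∞ (bump d) := ContDiffBump.contDiff_normed _

theorem bump_nonneg (x : Vec d) : 0 ≤ bump d x := ContDiffBump.nonneg_normed _ x

theorem integral_bump : ∫ x, bump d x = 1 := ContDiffBump.integral_normed _

theorem hasCompactSupport_bump : HasCompactSupport (bump d) :=
  ContDiffBump.hasCompactSupport_normed _

theorem integrable_bump : Integrable (bump d) :=
  contDiff_bump.continuous.integrable_of_hasCompactSupport hasCompactSupport_bump

theorem bump_eq_zero {x : Vec d} (hx : 1 ≤ ‖x‖) : bump d x = 0 := by
  have h : Function.support (bump d) = Metric.ball 0 1 := ContDiffBump.support_normed_eq _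
  rw [← Function.notMem_support, h, mem_ball_zero_iff]
  exact hx.not_gt

theorem integrable_bump_smul {g : Vec d → ℂ} (hg : Continuous g) :
    Integrable fun y => bump d y • g y :=
  (contDiff_bump.continuous.smul hg).integrable_of_hasCompactSupport
    hasCompactSupport_bump.smul_right

theorem norm_integral_bump_smul_le {g : Vec d → ℂ} {B : ℝ} (hB : ∀ y, ‖y‖ < 1 → ‖g y‖ ≤ B) :
    ‖∫ y, bump d y • g y‖ ≤ B := by
  have hle : ∀ y, ‖bump d y • g y‖ ≤ bump d y * B := by
    intro y
    rw [norm_smul, Real.norm_of_nonneg (bump_nonneg y)]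
    rcases le_or_gt 1 ‖y‖ with hy | hy
    · rw [bump_eq_zero hy, zero_mul, zero_mul]
    · exact mul_le_mul_of_nonneg_left (hB y hy) (bump_nonneg y)
  refine (norm_integral_le_of_norm_le (integrable_bump.mul_const B) (.of_forall hle)).trans_eq ?_
  rw [integral_mul_const, integral_bump, one_mul]

/-- The bump function rescaled to support in the ball of radius `s` and integral `1`. -/
def scaledBump (d : ℕ) (s : ℝ) (x : Vec d) : ℂ := (s⁻¹ ^ d * bump d (s⁻¹ • x) : ℝ)

theorem contDiff_scaledBump (s : ℝ) : ContDiff ℝ ∞ (scaledBump d s) :=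
  Complex.ofRealCLM.contDiff.comp
    (contDiff_const.mul (contDiff_bump.comp (contDiff_const_smul s⁻¹)))

theorem scaledBump_eq_zero {s : ℝ} (hs : 0 < s) {x : Vec d} (hx : s ≤ ‖x‖) :
    scaledBump d s x = 0 := by
  rw [scaledBump, bump_eq_zero, mul_zero, Complex.ofReal_zero]
  rwa [norm_smul, norm_inv, Real.norm_of_nonneg hs.le, ← div_eq_inv_mul, one_le_div hs]

theorem scaledBump_mul {s : ℝ} (hs : 0 < s) (g : Vec d → ℂ) (x : Vec d) :
    scaledBump d s x * g x =
      (fun y => s⁻¹ ^ d • bump d y • g (s • y)) (s⁻¹ • x) := by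
  simp only [scaledBump, smul_smul, mul_inv_cancel₀ hs.ne', one_smul, Complex.real_smul,
    Complex.ofReal_mul, mul_assoc]

theorem integrable_scaledBump_mul {s : ℝ} (hs : 0 < s) {g : Vec d → ℂ} (hg : Continuous g) :
    Integrable fun x => scaledBump d s x * g x := by
  simp_rw [scaledBump_mul hs g]
  exact ((integrable_bump_smul (hg.comp (continuous_const_smul s))).smul (s⁻¹ ^ d)).comp_smul
    (inv_ne_zero hs.ne')

theorem integral_scaledBump_mul {s : ℝ} (hs : 0 < s) (g : Vec d → ℂ) :
    ∫ x, scaledBump d s x * g x = ∫ y, bump d y • g (s • y) := by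
  simp_rw [scaledBump_mul hs g]
  rw [Measure.integral_comp_smul volume (fun y : Vec d => s⁻¹ ^ d • bump d y • g (s • y)) s⁻¹,
    finrank_euclideanSpace_fin, integral_smul, smul_smul, abs_of_pos (by positivity),
    inv_mul_cancel₀ (by positivity), one_smul]

theorem exists_norm_iteratedFDeriv_scaledBump_le (d j : ℕ) : ∃ M, 0 ≤ M ∧ ∀ s : ℝ, 0 < s →
    ∀ x, ‖iteratedFDeriv ℝ j (scaledBump d s) x‖ ≤ M * s⁻¹ ^ (d + j) := by
  have hb : ContDiff ℝ ∞ fun x => (bump d x : ℂ) := Complex.ofRealCLM.contDiff.comp contDiff_bump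
  have hsupp : HasCompactSupport fun x => (bump d x : ℂ) :=
    hasCompactSupport_bump.comp_left (g := Complex.ofReal) Complex.ofReal_zero
  obtain ⟨M, hM⟩ := exists_bound_iteratedFDeriv_of_hasCompactSupport hb hsupp j
  refine ⟨M, (norm_nonneg _).trans (hM 0), fun s hs x => ?_⟩
  let A : Vec d →L[ℝ] Vec d := s⁻¹ • ContinuousLinearMap.id ℝ (Vec d)
  have hA : ‖A‖ ≤ s⁻¹ := by
    rw [norm_smul, Real.norm_of_nonneg (inv_pos.2 hs).le]
    exact mul_le_of_le_one_right (inv_pos.2 hs).le ContinuousLinearMap.norm_id_le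
  have hscaled : scaledBump d s = fun x => s⁻¹ ^ d • (bump d (A x) : ℂ) := by
    ext x
    simp [scaledBump, A]
  have hbA : ContDiff ℝ j fun x => (bump d (A x) : ℂ) :=
    (hb.comp A.contDiff).of_le (by exact_mod_cast le_top)
  rw [hscaled, iteratedFDeriv_const_smul_apply' hbA.contDiffAt, norm_smul,
    Real.norm_of_nonneg (by positivity)]
  calc s⁻¹ ^ d * ‖iteratedFDeriv ℝ j (fun x => (bump d (A x) : ℂ)) x‖
      ≤ s⁻¹ ^ d * (M * s⁻¹ ^ j) := by
        gcongr
        refine (norm_iteratedFDeriv_comp_continuousLinearMap_le hb A j x).trans ?_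
        gcongr
        · exact (norm_nonneg _).trans (hM 0)
        · exact hM _
    _ = M * s⁻¹ ^ (d + j) := by ring

/-- A mollifier of radius `r` whose moments of the orders `1, …, m` vanish: the extrapolation to
radius `0` of the bump functions of the radii `r, r/2, …, r/(m+1)`. -/
def mollifier (d m : ℕ) (r : ℝ) (x : Vec d) : ℂ :=
  ∑ k ∈ Finset.range (m + 1), weight m k • scaledBump d (r * scale k) x

theorem contDiff_mollifier (m : ℕ) (r : ℝ) : ContDiff ℝ ∞ (mollifier d m r) :=
  ContDiff.sum fun _ _ => (contDiff_scaledBump _).const_smul _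

theorem mollifier_eq_zero {m : ℕ} {r : ℝ} (hr : 0 < r) {x : Vec d} (hx : r ≤ ‖x‖) :
    mollifier d m r x = 0 := by
  refine Finset.sum_eq_zero fun k _ => ?_
  rw [scaledBump_eq_zero (mul_pos hr (scale_pos k))
    ((mul_le_of_le_one_right hr.le (scale_le_one k)).trans hx), smul_zero]

theorem integral_mollifier_mul (m : ℕ) {r : ℝ} (hr : 0 < r) {g : Vec d → ℂ} (hg : Continuous g) :
    ∫ x, mollifier d m r x * g x =
      ∫ y, bump d y • ∑ k ∈ Finset.range (m + 1), weight m k • g ((r * scale k) • y) := by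
  have hpos : ∀ k, 0 < r * scale k := fun k => mul_pos hr (scale_pos k)
  have hint : ∀ k, Integrable fun y => bump d y • g ((r * scale k) • y) := fun k =>
    integrable_bump_smul (hg.comp (continuous_const_smul _))
  simp_rw [mollifier, Finset.sum_mul, Finset.smul_sum, smul_mul_assoc, smul_comm (bump d _)]
  rw [integral_finsetSum _ fun k _ => (integrable_scaledBump_mul (hpos k) hg).fun_smul (weight m k),
    integral_finsetSum _ fun k _ => (hint k).fun_smul (weight m k)]
  simp_rw [integral_smul, integral_scaledBump_mul (hpos _)]

theorem integral_mollifier_mul_homogeneous {m j : ℕ} (hj : j ≤ m) {r : ℝ} (hr : 0 < r)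
    {g : Vec d → ℂ} (hg : Continuous g) (hhom : ∀ (t : ℝ) y, g (t • y) = t ^ j • g y) :
    ∫ x, mollifier d m r x * g x = 0 ^ j * ∫ y, bump d y • g y := by
  have hsum : ∀ y, ∑ k ∈ Finset.range (m + 1), weight m k • g ((r * scale k) • y) =
      (0 : ℂ) ^ j * g y := by
    intro y
    have hzero : r ^ j * (0 : ℝ) ^ j = 0 ^ j := by rw [← mul_pow, mul_zero]
    simp_rw [hhom, smul_smul, mul_pow, mul_left_comm _ (r ^ j)]
    rw [← Finset.sum_smul, ← Finset.mul_sum, sum_weight_mul_pow hj, hzero, Complex.real_smul]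
    push_cast
    rfl
  simp_rw [integral_mollifier_mul m hr hg, hsum, ← mul_smul_comm, integral_const_mul]

theorem norm_integral_mollifier_mul_sub_le {m n : ℕ} (hn : n ≤ m) {r : ℝ} (hr : 0 < r)
    {g : Vec d → ℂ} (hg : ContDiff ℝ ∞ g) {C : ℝ} (x : Vec d)
    (hC : ∀ z ∈ Metric.closedBall x r, ‖iteratedFDeriv ℝ (n + 1) g z‖ ≤ C) :
    ‖(∫ y, mollifier d m r y * g (x - y)) - g x‖ ≤ weightNorm m * (C * r ^ (n + 1)) := by
  have hC0 : 0 ≤ C := (norm_nonneg _).trans (hC x (Metric.mem_closedBall_self hr.le))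
  have hgc : Continuous g := hg.continuous
  have hgs : Continuous fun y => ∑ k ∈ Finset.range (m + 1),
      weight m k • g (x - (r * scale k) • y) := by fun_prop
  have herror : (∫ y, mollifier d m r y * g (x - y)) - g x = ∫ y, bump d y •
      (∑ k ∈ Finset.range (m + 1), weight m k • g (x - (r * scale k) • y) - g x) := by
    simp_rw [smul_sub]
    rw [integral_sub (integrable_bump_smul hgs) (integrable_bump_smul continuous_const),
      integral_smul_const, integral_bump, one_smul,
      integral_mollifier_mul m hr (g := fun y => g (x - y)) (by fun_prop)]
  rw [herror]
  refine norm_integral_bump_smul_le fun y hy => ?_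
  have hv : ‖-(r • y)‖ ≤ r := by
    rw [norm_neg, norm_smul, Real.norm_of_nonneg hr.le]
    exact mul_le_of_le_one_right hr.le hy.le
  have hline : ∀ k, x - (r * scale k) • y = x + scale k • -(r • y) := fun k => by
    rw [smul_neg, smul_smul, mul_comm, sub_eq_add_neg]
  simp_rw [hline]
  refine (norm_sum_weight_smul_line_sub_le hg hn x (-(r • y)) fun z hz =>
    hC z (Metric.closedBall_subset_closedBall hv hz)).trans ?_
  exact mul_le_mul_of_nonneg_left (by gcongr) (weightNorm_nonneg m)

theorem exists_norm_iteratedFDeriv_mollifier_le (d j : ℕ) : ∃ M, 0 ≤ M ∧ ∀ (m : ℕ) (r : ℝ), 0 < r →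
    (m : ℝ) + 1 ≤ r⁻¹ → ∀ x,
      ‖iteratedFDeriv ℝ j (mollifier d m r) x‖ ≤ weightNorm m * M * (r⁻¹ ^ 2) ^ (d + j) := by
  obtain ⟨M, hM0, hM⟩ := exists_norm_iteratedFDeriv_scaledBump_le d j
  refine ⟨M, hM0, fun m r hr hm x => ?_⟩
  have hscale : ∀ k ∈ Finset.range (m + 1), (r * scale k)⁻¹ ≤ r⁻¹ ^ 2 := by
    intro k hk
    rw [mul_inv, pow_two, scale, one_div, inv_inv]
    refine mul_le_mul_of_nonneg_left (le_trans ?_ hm) (inv_pos.2 hr).le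
    gcongr
    exact Finset.mem_range_succ_iff.1 hk
  have hcd : ∀ k, ContDiffAt ℝ j (scaledBump d (r * scale k)) x := fun k =>
    ((contDiff_scaledBump _).of_le (by exact_mod_cast le_top)).contDiffAt
  change ‖iteratedFDeriv ℝ j (fun x => ∑ k ∈ Finset.range (m + 1),
    weight m k • scaledBump d (r * scale k) x) x‖ ≤ _
  rw [iteratedFDeriv_fun_sum_apply fun k _ => (hcd k).const_smul _, weightNorm, Finset.sum_mul,
    Finset.sum_mul]
  refine norm_sum_le_of_le _ fun k hk => ?_
  have hpos : 0 < r * scale k := mul_pos hr (scale_pos k)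
  rw [iteratedFDeriv_const_smul_apply' (hcd k), norm_smul, Real.norm_eq_abs, mul_assoc]
  refine mul_le_mul_of_nonneg_left ((hM _ hpos x).trans ?_) (abs_nonneg _)
  gcongr
  exact hscale k hk

/-- The order of the mollifier of radius `r`: it tends to infinity for `r → 0`, but so slowly that
the weights stay below `r⁻¹`. -/
def mollifierOrder (r : ℝ) : ℕ :=
  Nat.findGreatest (fun m => weightNorm m + ((m : ℝ) + 1) ≤ r⁻¹) ⌊r⁻¹⌋₊

theorem mollifierOrder_spec {r : ℝ} (h0 : 0 < r) (hr : r ≤ 1 / 2) :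
    weightNorm (mollifierOrder r) + ((mollifierOrder r : ℝ) + 1) ≤ r⁻¹ := by
  refine Nat.findGreatest_spec (P := fun m : ℕ => weightNorm m + ((m : ℝ) + 1) ≤ r⁻¹) (m := 0)
    (Nat.zero_le _) ?_
  rw [weightNorm_zero, Nat.cast_zero, zero_add, ← one_div, le_div_iff₀ h0]
  linarith

theorem le_mollifierOrder {r : ℝ} {N : ℕ} (h : weightNorm N + ((N : ℝ) + 1) ≤ r⁻¹) :
    N ≤ mollifierOrder r := by
  refine Nat.le_findGreatest (Nat.le_floor ?_) h
  linarith [weightNorm_nonneg N]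

end Mollifier

/-! ### Cut-off functions -/

section Cutoff

/-- A real smooth function with compact support as a complex test function. -/
def ofRealTest {E : Type*} [NormedAddCommGroup E] [NormedSpace ℝ E] {Ω : Opens E} (g : E → ℝ)
    (hg : ContDiff ℝ ∞ g) (hc : HasCompactSupport g) (hΩ : tsupport g ⊆ Ω) : 𝓓(Ω, ℂ) where
  toFun x := (g x : ℂ)
  contDiff' := Complex.ofRealCLM.contDiff.comp hg
  hasCompactSupport' := hc.comp_left (g := Complex.ofReal) Complex.ofReal_zero
  tsupport_subset' := (tsupport_comp_subset (g := Complex.ofReal) Complex.ofReal_zero g).trans hΩ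

theorem sub_le_dist_of_mem_cthickening {X : Type*} [PseudoMetricSpace X] {K : Set X}
    (hK : IsCompact K) {r s : ℝ} (hr : 0 ≤ r) {x y : X} (hs : ∀ z ∈ K, s ≤ dist z y)
    (hx : x ∈ Metric.cthickening r K) : s - r ≤ dist x y := by
  rw [hK.cthickening_eq_biUnion_closedBall hr, Set.mem_iUnion₂] at hx
  obtain ⟨z, hz, hxz⟩ := hx
  linarith [hs z hz, dist_triangle_left z y x, Metric.mem_closedBall.1 hxz]

open scoped Manifold in
theorem exists_testFunction_eq_one_of_cthickening_subset {E : Type*} [NormedAddCommGroup E]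
    [NormedSpace ℝ E] [FiniteDimensional ℝ E] {Ω : Opens E} {K : Set E} (hK : IsCompact K) {r : ℝ}
    (hr : 0 < r) (hΩ : Metric.cthickening r K ⊆ Ω) :
    ∃ p : 𝓓(Ω, ℂ), (∀ x ∈ K, p x = 1) ∧ tsupport p ⊆ Metric.cthickening r K := by
  obtain ⟨f, hf1, hf0, -⟩ := exists_contMDiffMap_one_nhds_of_subset_interior (n := (⊤ : ℕ∞))
    𝓘(ℝ, E) hK.isClosed ((Metric.self_subset_thickening hr K).trans
      (interior_maximal (Metric.thickening_subset_cthickening r K) Metric.isOpen_thickening))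
  have hsupp : tsupport f ⊆ Metric.cthickening r K :=
    tsupport_subset_of_forall_eq_zero Metric.isClosed_cthickening hf0
  have := FiniteDimensional.proper_real E
  exact ⟨ofRealTest f f.contMDiff.contDiff
      (hK.cthickening.of_isClosed_subset (isClosed_tsupport _) hsupp) (hsupp.trans hΩ),
    fun x hx => congrArg Complex.ofReal (hf1.self_of_nhdsSet x hx),
    (tsupport_comp_subset (g := Complex.ofReal) Complex.ofReal_zero f).trans hsupp⟩

theorem exists_cutoff {E : Type*} [NormedAddCommGroup E] [NormedSpace ℝ E] [FiniteDimensional ℝ E]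
    (Ω : Opens E) {r : ℝ} (hr : 0 < r) : ∃ p : 𝓓(Ω, ℂ),
      (∀ x : E, ‖x‖ ≤ r⁻¹ → (∀ y ∉ Ω, 3 * r ≤ dist x y) → p x = 1) ∧
      ∀ x ∈ tsupport p, ∀ y ∈ frontier (Ω : Set E), r ≤ ‖x - y‖ := by
  have := FiniteDimensional.proper_real E
  let K : Set E := Metric.closedBall 0 r⁻¹ ∩ ⋂ y ∈ (Ω : Set E)ᶜ, {x | 3 * r ≤ dist x y}
  have hK : IsCompact K := (isCompact_closedBall 0 r⁻¹).inter_right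
    (isClosed_biInter fun y _ => isClosed_le continuous_const (continuous_id.dist continuous_const))
  have hdist : ∀ x ∈ Metric.cthickening r K, ∀ y ∉ Ω, 2 * r ≤ dist x y := fun x hx y hy => by
    linarith [sub_le_dist_of_mem_cthickening hK hr.le
      (fun z hz => Set.mem_iInter₂.1 hz.2 y hy : ∀ z ∈ K, 3 * r ≤ dist z y) hx]
  have hΩ : Metric.cthickening r K ⊆ Ω := fun x hx => by
    by_contra hxΩ
    have := hdist x hx x hxΩ
    rw [dist_self] at this
    linarith
  obtain ⟨p, hp1, hp⟩ := exists_testFunction_eq_one_of_cthickening_subset hK hr hΩ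
  refine ⟨p, fun x hx hxΩ => hp1 x ⟨by simpa using hx, Set.mem_iInter₂.2 hxΩ⟩, fun x hx y hy => ?_⟩
  rw [Ω.isOpen.frontier_eq] at hy
  rw [← dist_eq_norm]
  linarith [hdist x (hp hx) y hy.2]

theorem exists_forall_norm_le_inv_and_le_dist {E : Type*} [SeminormedAddCommGroup E] {Ω : Opens E}
    {L : Set E} (hL : IsCompact L) (h : L ⊆ Ω) :
    ∃ δ > 0, ∀ r : ℝ, 0 < r → r ≤ δ → ∀ x ∈ L, ‖x‖ ≤ r⁻¹ ∧ ∀ y ∉ Ω, 3 * r ≤ dist x y := by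
  obtain ⟨δ, hδ, hδΩ⟩ := hL.exists_cthickening_subset_open Ω.isOpen h
  obtain ⟨R, hR⟩ := hL.isBounded.exists_norm_le
  refine ⟨min (δ / 3) (|R| + 1)⁻¹, by positivity, fun r h0 hr x hx => ⟨?_, fun y hy => ?_⟩⟩
  · calc ‖x‖ ≤ |R| + 1 := by linarith [hR x hx, le_abs_self R]
      _ ≤ r⁻¹ := (le_inv_comm₀ (by positivity) h0).2 (hr.trans (min_le_right _ _))
  · by_contra hn
    refine hy (hδΩ (Metric.mem_cthickening_of_dist_le y x δ L hx ?_))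
    rw [dist_comm]
    linarith [hr.trans (min_le_left _ _)]

end Cutoff

/-! ### Distributions given by smooth functions -/

section OfSmooth

variable {d : ℕ} {Ω : Opens (Vec d)}

theorem lineDerivCLM_apply (φ : 𝓓(Ω, ℂ)) (v ξ : Vec d) :
    (TestFunction.lineDerivCLM ℂ v φ : 𝓓(Ω, ℂ)) ξ = fderiv ℝ φ ξ v := by
  rw [TestFunction.lineDerivCLM_eq_fderivCLM, TestFunction.fderivCLM_apply_of_le _ (by simp)]

theorem Distr.pderiv_apply (j : Fin d) (T : Distr Ω) (φ : 𝓓(Ω, ℂ)) :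
    Distr.pderiv j T φ = -T (TestFunction.lineDerivCLM ℂ (unitVec j) φ) := rfl

theorem contDiff_mul_extZero (φ : 𝓓(Ω, ℂ)) (f : Smooth Ω) :
    ContDiff ℝ ∞ fun x => φ x * extZero f.1 x := by
  refine contDiff_iff_contDiffAt.2 fun x => ?_
  by_cases hx : x ∈ tsupport φ
  · exact φ.contDiff.contDiffAt.mul (Smooth.contDiffAt f (φ.tsupport_subset hx))
  · refine contDiffAt_const.congr_of_eventuallyEq (f := fun _ => 0) ?_
    filter_upwards [(isClosed_tsupport φ).isOpen_compl.mem_nhds hx] with y hy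
    rw [image_eq_zero_of_notMem_tsupport hy, zero_mul]

theorem integrable_mul_extZero (φ : 𝓓(Ω, ℂ)) (f : Smooth Ω) :
    Integrable fun x => φ x * extZero f.1 x :=
  (contDiff_mul_extZero φ f).continuous.integrable_of_hasCompactSupport
    φ.hasCompactSupport.mul_right

theorem ofSmooth_apply_eq_integral (f : Smooth Ω) (φ : 𝓓(Ω, ℂ)) :
    Distr.ofSmooth f φ = ∫ x, extZero f.1 x * φ x := by
  rw [Distr.ofSmooth_apply, setIntegral_eq_integral_of_forall_compl_eq_zero]
  intro x hx
  rw [eq_zero_of_tsupport_subset φ.tsupport_subset hx, mul_zero]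

theorem Distr.ofSmooth_injective : Function.Injective (Distr.ofSmooth (Ω := Ω)) := by
  refine (injective_iff_map_eq_zero _).2 fun f hf => ?_
  have hae : ∀ᵐ x, x ∈ (Ω : Set (Vec d)) → extZero f.1 x = 0 := by
    refine Ω.isOpen.ae_eq_zero_of_integral_contDiff_smul_eq_zero (Smooth.locallyIntegrableOn f)
      fun g hg hc hΩ => ?_
    have hzero : ∫ x, extZero f.1 x * (g x : ℂ) = 0 :=
      (ofSmooth_apply_eq_integral f (ofRealTest g hg hc hΩ)).symm.trans (by rw [hf]; rfl)
    simpa only [Complex.real_smul, mul_comm] using hzero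
  have heq : Set.EqOn (extZero f.1) 0 Ω :=
    Measure.eqOn_open_of_ae_eq ((ae_restrict_iff' Ω.isOpen.measurableSet).2 hae) Ω.isOpen
      f.2.continuousOn continuousOn_const
  exact Subtype.ext (funext fun x => (extZero_coe f.1 x).symm.trans (heq x.2))

theorem pderiv_ofSmooth (j : Fin d) (f : Smooth Ω) :
    Distr.pderiv j (Distr.ofSmooth f) = Distr.ofSmooth (Smooth.pderiv j f) := by
  ext φ
  have hpderiv : ∀ x, fderiv ℝ (extZero f.1) x (unitVec j) * φ x =
      extZero (Smooth.pderiv j f).1 x * φ x := by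
    intro x
    by_cases hx : x ∈ Ω
    · rw [extZero_mem _ hx]
      rfl
    · rw [eq_zero_of_tsupport_subset φ.tsupport_subset hx, mul_zero, mul_zero]
  rw [Distr.pderiv_apply, ofSmooth_apply_eq_integral, ofSmooth_apply_eq_integral]
  simp_rw [lineDerivCLM_apply, ← hpderiv]
  rw [integral_mul_fderiv_eq_neg_fderiv_mul_of_integrable, neg_neg]
  · simp_rw [hpderiv, mul_comm _ (φ _)]
    exact integrable_mul_extZero φ _
  · simp_rw [← lineDerivCLM_apply, mul_comm (extZero _ _)]
    exact integrable_mul_extZero _ f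
  · simp_rw [mul_comm _ (φ _)]
    exact integrable_mul_extZero φ f
  · exact fun x hx => Smooth.differentiableAt f (φ.tsupport_subset hx)
  · exact fun x _ => (φ.contDiff.differentiable (by simp)).differentiableAt

end OfSmooth

/-! ### Regularization by convolution -/

section Regularize

variable {d : ℕ} {Ω : Opens (Vec d)} {p : 𝓓(Ω, ℂ)} {f : Smooth (⊤ : Opens (Vec d))} {x : Vec d}
  {r s : ℝ}

theorem contDiff_extZero_top (f : Smooth (⊤ : Opens (Vec d))) : ContDiff ℝ ∞ (extZero f.1) :=
  contDiffOn_univ.1 (f.2 : ContDiffOn ℝ ∞ (extZero f.1) (⊤ : Opens (Vec d)))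

theorem extZero_pderiv_top (f : Smooth (⊤ : Opens (Vec d))) (j : Fin d) (x : Vec d) :
    extZero (Smooth.pderiv j f).1 x = fderiv ℝ (extZero f.1) x (unitVec j) :=
  extZero_mem (Smooth.pderiv j f).1 (show x ∈ (⊤ : Opens (Vec d)) from trivial)

/-- The support of a test function as a bundled compact set. -/
def suppCompacts (p : 𝓓(Ω, ℂ)) : Compacts (Vec d) := ⟨tsupport p, p.hasCompactSupport⟩

theorem cutTranslate_apply (p : 𝓓(Ω, ℂ)) (f : Smooth (⊤ : Opens (Vec d))) (x ξ : Vec d) :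
    cutTranslate p f x ξ = p ξ * extZero f.1 (x - ξ) := rfl

theorem isSmoothFamily_cutTranslate (p : 𝓓(Ω, ℂ)) (f : Smooth (⊤ : Opens (Vec d))) :
    IsSmoothFamily (cutTranslate p f) (suppCompacts p) where
  contDiff := (p.contDiff.comp contDiff_snd).mul
    ((contDiff_extZero_top f).comp (contDiff_fst.sub contDiff_snd))
  subset := p.tsupport_subset
  tsupport_subset _ := tsupport_mul_subset_left

/-- The regularization `(T p) ⋆ f` of a distribution: the convolution of `f` with the compactly
supported distribution `T p`. -/
def regularize (T : Distr Ω) (p : 𝓓(Ω, ℂ)) (f : Smooth (⊤ : Opens (Vec d))) : Smooth Ω :=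
  ⟨fun x => T (cutTranslate p f x),
    ((isSmoothFamily_cutTranslate p f).contDiff_apply T).contDiffOn.congr fun _ hx =>
      extZero_mem (fun x : Ω => T (cutTranslate p f x)) hx⟩

theorem extZero_regularize (T : Distr Ω) (p : 𝓓(Ω, ℂ)) (f : Smooth (⊤ : Opens (Vec d)))
    (hx : x ∈ Ω) : extZero (regularize T p f).1 x = T (cutTranslate p f x) :=
  extZero_mem (regularize T p f).1 hx

theorem pderiv_regularize (T : Distr Ω) (p : 𝓓(Ω, ℂ)) (f : Smooth (⊤ : Opens (Vec d)))
    (j : Fin d) : Smooth.pderiv j (regularize T p f) = regularize T p (Smooth.pderiv j f) := by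
  refine Subtype.ext (funext fun x => ?_)
  have hu := isSmoothFamily_cutTranslate p f
  have heq : extZero (regularize T p f).1 =ᶠ[nhds x.1] fun x => T (cutTranslate p f x) :=
    extZero_eventuallyEq (regularize T p f).1 (fun x => T (cutTranslate p f x)) (fun _ => rfl) x.2
  have hdir : hu.dirDeriv (unitVec j) x.1 = cutTranslate p (Smooth.pderiv j f) x := by
    ext ξ
    have hd : DifferentiableAt ℝ (fun y => extZero f.1 (y - ξ)) x.1 :=
      ((contDiff_extZero_top f).differentiable (by simp)).differentiableAt.comp x.1
        (differentiableAt_id.sub_const ξ)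
    rw [hu.dirDeriv_apply, cutTranslate_apply, extZero_pderiv_top]
    simp only [cutTranslate_apply]
    rw [fderiv_const_mul hd, fderiv_comp_sub]
    rfl
  rw [Smooth.pderiv_apply, heq.fderiv_eq, (hu.hasFDerivAt_apply T x.1).fderiv,
    hu.applyFDeriv_apply, hdir]
  rfl

/-- The test function `p` is equal to `1` on the ball of radius `r` around `x`. -/
def IsOneNear (p : 𝓓(Ω, ℂ)) (x : Vec d) (r : ℝ) : Prop := ∀ ξ ∈ Metric.ball x r, p ξ = 1

/-- The function `f` vanishes outside of the ball of radius `r` around `0`. -/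
def VanishesOff (f : Smooth (⊤ : Opens (Vec d))) (r : ℝ) : Prop :=
  ∀ y, r ≤ ‖y‖ → extZero f.1 y = 0

theorem IsOneNear.mono (hp : IsOneNear p x s) (h : r ≤ s) : IsOneNear p x r :=
  fun ξ hξ => hp ξ (Metric.ball_subset_ball h hξ)

theorem VanishesOff.mem_ball (hf : VanishesOff f r) {ξ : Vec d} (h : extZero f.1 (x - ξ) ≠ 0) :
    ξ ∈ Metric.ball x r := by
  rw [Metric.mem_ball, dist_comm, dist_eq_norm]
  exact not_le.1 fun hn => h (hf _ hn)

theorem VanishesOff.fderiv_eq_zero (hf : VanishesOff f r) {y : Vec d} (hy : r < ‖y‖) :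
    fderiv ℝ (extZero f.1) y = 0 := by
  have h : extZero f.1 =ᶠ[nhds y] fun _ => 0 :=
    (continuous_norm.continuousAt.eventually (lt_mem_nhds hy)).mono fun z hz => hf z hz.le
  rw [h.fderiv_eq, fderiv_fun_const, Pi.zero_apply]

theorem IsOneNear.coe_cutTranslate (hp : IsOneNear p x r) (hf : VanishesOff f r) :
    ⇑(cutTranslate p f x) = fun ξ => extZero f.1 (x - ξ) := by
  ext ξ
  rw [cutTranslate_apply]
  by_cases h : extZero f.1 (x - ξ) = 0
  · rw [h, mul_zero]
  · rw [hp ξ (hf.mem_ball h), one_mul]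

theorem pderiv_apply_cutTranslate (T : Distr Ω) (hrs : r < s) (hp : IsOneNear p x s)
    (hf : VanishesOff f r) (j : Fin d) :
    Distr.pderiv j T (cutTranslate p f x) = T (cutTranslate p (Smooth.pderiv j f) x) := by
  rw [Distr.pderiv_apply, ← map_neg]
  congr 1
  ext ξ
  have hd : HasFDerivAt (fun ξ => extZero f.1 (x - ξ))
      ((fderiv ℝ (extZero f.1) (x - ξ)).comp (-ContinuousLinearMap.id ℝ (Vec d))) ξ :=
    (((contDiff_extZero_top f).differentiable (by simp)).differentiableAt.hasFDerivAt).comp ξ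
      ((hasFDerivAt_id ξ).const_sub x)
  change -((TestFunction.lineDerivCLM ℂ (unitVec j) (cutTranslate p f x) : 𝓓(Ω, ℂ)) ξ) = _
  rw [lineDerivCLM_apply, cutTranslate_apply, extZero_pderiv_top,
    (hp.mono hrs.le).coe_cutTranslate hf, hd.fderiv]
  by_cases hξ : ξ ∈ Metric.ball x s
  · simp [hp ξ hξ]
  · rw [Metric.mem_ball, dist_comm, dist_eq_norm, not_lt] at hξ
    simp [hf.fderiv_eq_zero (hrs.trans_le hξ)]

theorem restrict_apply_cutTranslate {O : Opens (Vec d)} (h : O ≤ Ω) (T : Distr Ω) {q : 𝓓(O, ℂ)}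
    (hp : IsOneNear p x r) (hq : IsOneNear q x r) (hf : VanishesOff f r) :
    Distr.restrict h T (cutTranslate q f x) = T (cutTranslate p f x) := by
  change T (TestFunction.monoCLM ℂ (cutTranslate q f x)) = _
  congr 1
  ext ξ
  rw [TestFunction.monoCLM_apply, if_pos ⟨le_rfl, h⟩, hp.coe_cutTranslate hf,
    hq.coe_cutTranslate hf]

theorem tsupport_cutTranslate_subset_closedBall (hp : IsOneNear p x r) (hf : VanishesOff f r) :
    tsupport (cutTranslate p f x) ⊆ Metric.closedBall x r := by
  refine tsupport_subset_of_forall_eq_zero Metric.isClosed_closedBall fun ξ hξ => ?_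
  rw [hp.coe_cutTranslate hf]
  exact of_not_not fun hn => hξ (Metric.ball_subset_closedBall (hf.mem_ball hn))

theorem norm_iteratedFDeriv_cutTranslate_le (hp : IsOneNear p x r) (hf : VanishesOff f r) (k : ℕ)
    (ξ : Vec d) : ‖iteratedFDeriv ℝ k (cutTranslate p f x) ξ‖ ≤
      ‖iteratedFDeriv ℝ k (extZero f.1) (x - ξ)‖ := by
  have hfun : ⇑(cutTranslate p f x) = fun ξ => (fun z => extZero f.1 (x + z))
      (LinearIsometryEquiv.neg ℝ ξ) := by
    rw [hp.coe_cutTranslate hf]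
    simp [sub_eq_add_neg]
  rw [hfun]
  exact ((LinearIsometryEquiv.neg ℝ).norm_iteratedFDeriv_comp_right
    (fun z => extZero f.1 (x + z)) ξ k).trans_le
      (by simp [iteratedFDeriv_comp_add_left, sub_eq_add_neg])

theorem exists_norm_apply_cutTranslate_le (T : Distr Ω) {x₀ : Vec d} {ε : ℝ}
    (hε : Metric.closedBall x₀ ε ⊆ Ω) : ∃ (N : ℕ) (C : ℝ),
      ∀ (p : 𝓓(Ω, ℂ)) (f : Smooth (⊤ : Opens (Vec d))) (x : Vec d) (r M : ℝ),
        x ∈ Metric.ball x₀ (ε / 2) → r ≤ ε / 2 → IsOneNear p x r → VanishesOff f r → 0 ≤ M →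
        (∀ k ≤ N, ∀ y, ‖iteratedFDeriv ℝ k (extZero f.1) y‖ ≤ M) →
        ‖T (cutTranslate p f x)‖ ≤ C * M := by
  obtain ⟨N, C, h⟩ := exists_norm_apply_le T
    (K := ⟨Metric.closedBall x₀ ε, isCompact_closedBall x₀ ε⟩) hε
  refine ⟨N, C, fun p f x r M hx hr hp hf hM hb => h _ ?_ M hM fun k hk ξ =>
    (norm_iteratedFDeriv_cutTranslate_le hp hf k ξ).trans (hb k hk _)⟩
  exact (tsupport_cutTranslate_subset_closedBall hp hf).trans
    (Metric.closedBall_subset_closedBall' (by linarith [Metric.mem_ball.1 hx]))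

theorem ofSmooth_apply_cutTranslate (g : Smooth Ω) (hp : IsOneNear p x r) (hf : VanishesOff f r)
    {h : Vec d → ℂ} (hg : ∀ ξ ∈ Metric.ball x r, h ξ = extZero g.1 ξ) :
    Distr.ofSmooth g (cutTranslate p f x) = ∫ y, extZero f.1 y * h (x - y) := by
  rw [ofSmooth_apply_eq_integral,
    ← integral_sub_left_eq_self (fun y => extZero f.1 y * h (x - y)) volume x]
  refine integral_congr_ae (.of_forall fun ξ => ?_)
  simp only [hp.coe_cutTranslate hf, sub_sub_cancel]
  by_cases hξ : extZero f.1 (x - ξ) = 0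
  · rw [hξ, mul_zero, zero_mul]
  · rw [hg ξ (hf.mem_ball hξ), mul_comm]

end Regularize

/-! ### The delta net -/

section Delta

variable {d : ℕ} {Ω : Opens (Vec d)}

/-- The member of radius `r` of the delta net: as `r` decreases, more and more moments vanish. -/
def delta (d : ℕ) (r : ℝ) : Smooth (⊤ : Opens (Vec d)) :=
  ⟨fun x => mollifier d (mollifierOrder r) r x,
    (contDiff_mollifier (mollifierOrder r) r).contDiffOn.congr fun _ hx => extZero_mem _ hx⟩

theorem extZero_delta (d : ℕ) (r : ℝ) : extZero (delta d r).1 = mollifier d (mollifierOrder r) r :=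
  funext fun x => extZero_mem (delta d r).1 (show x ∈ (⊤ : Opens (Vec d)) from trivial)

theorem vanishesOff_delta (d : ℕ) {r : ℝ} (hr : 0 < r) : VanishesOff (delta d r) r :=
  fun y hy => by rw [extZero_delta, mollifier_eq_zero hr hy]

theorem weightNorm_mollifierOrder_le {r : ℝ} (h0 : 0 < r) (hr : r ≤ 1 / 2) :
    weightNorm (mollifierOrder r) ≤ r⁻¹ := by
  linarith [mollifierOrder_spec h0 hr, (mollifierOrder r).cast_nonneg (α := ℝ)]

theorem norm_integral_delta_mul_sub_le {n : ℕ} {r : ℝ} (h0 : 0 < r) (hr : r ≤ 1 / 2)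
    (hn : n ≤ mollifierOrder r) {g : Vec d → ℂ} (hg : ContDiff ℝ ∞ g) {C : ℝ} (x : Vec d)
    (hC : ∀ z ∈ Metric.closedBall x r, ‖iteratedFDeriv ℝ (n + 1) g z‖ ≤ C) :
    ‖(∫ y, extZero (delta d r).1 y * g (x - y)) - g x‖ ≤ C * r ^ n := by
  have hC0 : 0 ≤ C := (norm_nonneg _).trans (hC x (Metric.mem_closedBall_self h0.le))
  rw [extZero_delta]
  calc _ ≤ weightNorm (mollifierOrder r) * (C * r ^ (n + 1)) :=
        norm_integral_mollifier_mul_sub_le hn h0 hg x hC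
    _ ≤ r⁻¹ * (C * r ^ (n + 1)) := by
        gcongr
        exact weightNorm_mollifierOrder_le h0 hr
    _ = C * r ^ n := by
        rw [pow_succ]
        field_simp

theorem exists_norm_iteratedFDeriv_delta_le (d j : ℕ) : ∃ M : ℝ, 0 ≤ M ∧ ∀ r : ℝ, 0 < r →
    r ≤ 1 / 2 → ∀ x, ‖iteratedFDeriv ℝ j (extZero (delta d r).1) x‖ ≤
      M * r⁻¹ ^ (2 * (d + j) + 1) := by
  obtain ⟨M, hM0, hM⟩ := exists_norm_iteratedFDeriv_mollifier_le d j
  refine ⟨M, hM0, fun r h0 hr x => ?_⟩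
  have horder : (mollifierOrder r : ℝ) + 1 ≤ r⁻¹ := by
    linarith [mollifierOrder_spec h0 hr, weightNorm_nonneg (mollifierOrder r)]
  rw [extZero_delta]
  calc _ ≤ weightNorm (mollifierOrder r) * M * (r⁻¹ ^ 2) ^ (d + j) := hM _ r h0 horder x
    _ ≤ r⁻¹ * M * (r⁻¹ ^ 2) ^ (d + j) := by
        gcongr
        exact weightNorm_mollifierOrder_le h0 hr
    _ = M * r⁻¹ ^ (2 * (d + j) + 1) := by
        rw [← pow_mul, pow_succ]
        ring

theorem exists_norm_apply_cutTranslate_delta_le (T : Distr Ω) {x₀ : Vec d} {ε : ℝ}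
    (hε : Metric.closedBall x₀ ε ⊆ Ω) : ∃ (n : ℕ) (C : ℝ), ∀ (r : ℝ) (p : 𝓓(Ω, ℂ)) (x : Vec d),
      0 < r → r ≤ 1 / 2 → r ≤ ε / 2 → x ∈ Metric.ball x₀ (ε / 2) → IsOneNear p x r →
      ‖T (cutTranslate p (delta d r) x)‖ ≤ C * r⁻¹ ^ n := by
  obtain ⟨N, C, hT⟩ := exists_norm_apply_cutTranslate_le T hε
  choose M hM0 hM using exists_norm_iteratedFDeriv_delta_le d
  have hsum : 0 ≤ ∑ k ∈ Finset.range (N + 1), M k := Finset.sum_nonneg fun k _ => hM0 k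
  refine ⟨2 * (d + N) + 1, C * ∑ k ∈ Finset.range (N + 1), M k, fun r p x h0 hr hrε hx hp => ?_⟩
  have hinv : 1 ≤ r⁻¹ := (one_le_inv₀ h0).2 (hr.trans one_half_lt_one.le)
  rw [mul_assoc]
  refine hT p _ x r _ hx hrε hp (vanishesOff_delta d h0) (by positivity) fun k hk y => ?_
  calc _ ≤ M k * r⁻¹ ^ (2 * (d + k) + 1) := hM k r h0 hr y
    _ ≤ (∑ k ∈ Finset.range (N + 1), M k) * r⁻¹ ^ (2 * (d + N) + 1) := by
        gcongr
        exact Finset.single_le_sum (fun k _ => hM0 k) (Finset.mem_range.2 (by lia))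

theorem exists_norm_ofSmooth_apply_cutTranslate_delta_sub_le (f : Smooth Ω) {x₀ : Vec d} {ε : ℝ}
    (hε : 0 < ε) (h : Metric.closedBall x₀ ε ⊆ Ω) (n : ℕ) :
    ∃ C : ℝ, ∀ (r : ℝ) (p : 𝓓(Ω, ℂ)) (x : Vec d),
      0 < r → r ≤ 1 / 2 → n ≤ mollifierOrder r → r ≤ ε / 4 → x ∈ Metric.ball x₀ (ε / 4) →
      IsOneNear p x r →
      ‖Distr.ofSmooth f (cutTranslate p (delta d r) x) - extZero f.1 x‖ ≤ C * r ^ n := by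
  let χ : ContDiffBump x₀ := ⟨ε / 2, ε, by linarith, by linarith⟩
  let φ : 𝓓(Ω, ℂ) := ofRealTest χ χ.contDiff χ.hasCompactSupport (χ.tsupport_eq ▸ h)
  let g : Vec d → ℂ := fun x => φ x * extZero f.1 x
  have hg : ContDiff ℝ ∞ g := contDiff_mul_extZero φ f
  have hgf : ∀ x ∈ Metric.ball x₀ (ε / 2), g x = extZero f.1 x := fun x hx => by
    change (χ x : ℂ) * extZero f.1 x = _
    rw [χ.one_of_mem_closedBall (Metric.ball_subset_closedBall hx), Complex.ofReal_one, one_mul]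
  obtain ⟨C, hC⟩ := exists_bound_iteratedFDeriv_of_hasCompactSupport hg
    φ.hasCompactSupport.mul_right (n + 1)
  refine ⟨C, fun r p x h0 hr hn hrε hx hp => ?_⟩
  have hball : Metric.ball x r ⊆ Metric.ball x₀ (ε / 2) :=
    Metric.ball_subset_ball' (by linarith [Metric.mem_ball.1 hx])
  rw [ofSmooth_apply_cutTranslate f hp (vanishesOff_delta d h0) fun ξ hξ => hgf ξ (hball hξ),
    ← hgf x (hball (Metric.mem_ball_self h0))]
  exact norm_integral_delta_mul_sub_le h0 hr hn hg x fun z _ => hC z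

end Delta

/-! ### Pairing regularizations with test functions -/

theorem setIntegral_closedBall_mul_eq_integral {d : ℕ} {f : Smooth (⊤ : Opens (Vec d))}
    {r R : ℝ} (hf : VanishesOff f r) (hr : r ≤ R) (g : Vec d → ℂ) :
    ∫ y in Metric.closedBall (0 : Vec d) R, extZero f.1 y * g y = ∫ y, extZero f.1 y * g y := by
  refine setIntegral_eq_integral_of_forall_compl_eq_zero fun y hy => ?_
  rw [Metric.mem_closedBall, dist_zero_right, not_le] at hy
  rw [hf y (hr.trans hy.le), zero_mul]

section Pairing

variable {d : ℕ} {Ω : Opens (Vec d)} (φ : 𝓓(Ω, ℂ)) (χ : ContDiffBump (0 : Vec d))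

/-- The closed neighbourhood of radius `χ.rOut` of the support of a test function as a bundled
compact set. -/
def suppThickening : Compacts (Vec d) :=
  ⟨Metric.cthickening χ.rOut (tsupport φ), φ.hasCompactSupport.isCompact.cthickening⟩

theorem mem_suppThickening {y ξ : Vec d} (hφ : φ (ξ + y) ≠ 0) (hy : ‖y‖ ≤ χ.rOut) :
    ξ ∈ suppThickening φ χ :=
  Metric.mem_cthickening_of_dist_le ξ (ξ + y) _ _ (subset_tsupport φ hφ) (by simpa using hy)

theorem tsupport_mul_translate_subset (y : Vec d) :
    tsupport (fun ξ => (χ y : ℂ) * φ (ξ + y)) ⊆ suppThickening φ χ := by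
  refine tsupport_subset_of_forall_eq_zero Metric.isClosed_cthickening fun ξ hξ => ?_
  by_contra hn
  have hχ : χ y ≠ 0 := fun h => left_ne_zero_of_mul hn (by rw [h, Complex.ofReal_zero])
  have hy : dist y 0 < χ.rOut := not_le.1 fun h => hχ (χ.zero_of_le_dist h)
  exact hξ (mem_suppThickening φ χ (right_ne_zero_of_mul hn) (by simpa using hy.le))

variable (h : (suppThickening φ χ : Set (Vec d)) ⊆ Ω)

/-- The test function `ξ ↦ χ(y) φ(ξ + y)`; the factor `χ(y)` keeps its support inside `Ω` for all
`y`. -/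
def translateTest (y : Vec d) : 𝓓(Ω, ℂ) where
  toFun ξ := (χ y : ℂ) * φ (ξ + y)
  contDiff' := contDiff_const.mul (φ.contDiff.comp (contDiff_id.add contDiff_const))
  hasCompactSupport' := (suppThickening φ χ).isCompact.of_isClosed_subset (isClosed_tsupport _)
    (tsupport_mul_translate_subset φ χ y)
  tsupport_subset' := (tsupport_mul_translate_subset φ χ y).trans h

theorem translateTest_apply (y ξ : Vec d) : translateTest φ χ h y ξ = χ y * φ (ξ + y) := rfl

theorem isSmoothFamily_translateTest :
    IsSmoothFamily (translateTest φ χ h) (suppThickening φ χ) where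
  contDiff := (Complex.ofRealCLM.contDiff.comp (χ.contDiff.comp contDiff_fst)).mul
    (φ.contDiff.comp (contDiff_snd.add contDiff_fst))
  subset := h
  tsupport_subset := tsupport_mul_translate_subset φ χ

theorem translateTest_zero : translateTest φ χ h 0 = φ := by
  ext ξ
  rw [translateTest_apply, χ.one_of_mem_closedBall (Metric.mem_closedBall_self χ.rIn_pos.le),
    Complex.ofReal_one, one_mul, add_zero]

variable {f : Smooth (⊤ : Opens (Vec d))} {p : 𝓓(Ω, ℂ)} {r : ℝ} (hr : r ≤ χ.rIn)
  (hp : ∀ ξ ∈ suppThickening φ χ, p ξ = 1) (hf : VanishesOff f r)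

include hr hp hf

theorem mul_cutoff_mul_eq_mul_translateTest (y ξ : Vec d) :
    φ (ξ + y) * (p ξ * extZero f.1 y) = extZero f.1 y * translateTest φ χ h y ξ := by
  rw [translateTest_apply]
  by_cases hy : extZero f.1 y = 0
  · simp [hy]
  have hyr : ‖y‖ < χ.rIn := (not_le.1 fun hn => hy (hf y hn)).trans_le hr
  by_cases hφ : φ (ξ + y) = 0
  · simp [hφ]
  rw [hp ξ (mem_suppThickening φ χ hφ (hyr.trans χ.rIn_lt_rOut).le),
    χ.one_of_mem_closedBall (by simpa using hyr.le), Complex.ofReal_one]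
  ring

theorem setIntegral_mul_cutTranslate (ξ : Vec d) :
    ∫ x in tsupport φ, φ x * cutTranslate p f x ξ =
      ∫ y in Metric.closedBall (0 : Vec d) χ.rOut, extZero f.1 y * translateTest φ χ h y ξ := by
  rw [setIntegral_closedBall_mul_eq_integral hf (hr.trans χ.rIn_lt_rOut.le),
    setIntegral_eq_integral_of_forall_compl_eq_zero fun x hx => by
      rw [image_eq_zero_of_notMem_tsupport hx, zero_mul],
    ← integral_add_left_eq_self _ ξ]
  refine integral_congr_ae (.of_forall fun y => ?_)
  simp only [cutTranslate_apply, add_sub_cancel_left]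
  exact mul_cutoff_mul_eq_mul_translateTest φ χ h hr hp hf y ξ

theorem integral_mul_apply_cutTranslate (T : Distr Ω) :
    ∫ x in tsupport φ, φ x * T (cutTranslate p f x) =
      ∫ y, extZero f.1 y * T (translateTest φ χ h y) := by
  have hcut := (isSmoothFamily_cutTranslate p f).smul φ.contDiff
  have htranslate := (isSmoothFamily_translateTest φ χ h).smul (contDiff_extZero_top f)
  have hT := hcut.setIntegral_apply_congr (μ := volume) (ν := volume) htranslate T
    φ.hasCompactSupport (isCompact_closedBall _ _) (setIntegral_mul_cutTranslate φ χ h hr hp hf)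
  simp only [map_smul, smul_eq_mul] at hT
  rw [hT, setIntegral_closedBall_mul_eq_integral hf (hr.trans χ.rIn_lt_rOut.le)]

end Pairing

section WeakConvergence

variable {d : ℕ} {Ω : Opens (Vec d)}

theorem exists_norm_integral_mul_apply_cutTranslate_delta_sub_le (T : Distr Ω) (φ : 𝓓(Ω, ℂ))
    {ε : ℝ} (hε : 0 < ε) (h : Metric.cthickening ε (tsupport φ) ⊆ Ω) :
    ∃ C : ℝ, ∀ (r : ℝ) (p : 𝓓(Ω, ℂ)), 0 < r → r ≤ 1 / 2 → 1 ≤ mollifierOrder r → r ≤ ε / 2 →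
      (∀ ξ ∈ Metric.cthickening ε (tsupport φ), p ξ = 1) →
      ‖(∫ x in tsupport φ, φ x * T (cutTranslate p (delta d r) x)) - T φ‖ ≤ C * r := by
  let χ : ContDiffBump (0 : Vec d) := ⟨ε / 2, ε, by linarith, by linarith⟩
  let g : Vec d → ℂ := fun z => T (translateTest φ χ h (-z))
  have hg : ContDiff ℝ ∞ g :=
    ((isSmoothFamily_translateTest φ χ h).comp contDiff_neg).contDiff_apply T
  obtain ⟨C, hC⟩ := (isCompact_closedBall (0 : Vec d) 1).exists_bound_of_continuousOn
    (hg.continuous_iteratedFDeriv (m := 1 + 1) (by norm_cast)).continuousOn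
  refine ⟨C, fun r p h0 hr ho hrε hp => ?_⟩
  rw [integral_mul_apply_cutTranslate φ χ h hrε hp (vanishesOff_delta d h0)]
  have := norm_integral_delta_mul_sub_le h0 hr ho hg 0 fun z hz =>
    hC z (Metric.closedBall_subset_closedBall (by linarith) hz)
  simpa only [g, zero_sub, neg_neg, neg_zero, translateTest_zero φ χ h, pow_one] using this

end WeakConvergence

section Nonstandard

variable {I : Type*} {U : Ultrafilter I} {d : ℕ} {Ω : Opens (Vec d)}

/-! ### Representatives -/

theorem isInfinitesimal_coe {E : Type*} [NormedAddCommGroup E] {x : I → E} :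
    IsInfinitesimal (x : Star U E) ↔ Tendsto x U (nhds 0) := by
  have hn (n : ℕ) : starNorm (x : Star U E) < ((1 / ((n : ℝ) + 1) : ℝ) : Star U ℝ) ↔
      ∀ᶠ i in (U : Filter I), ‖x i‖ < 1 / ((n : ℝ) + 1) := Germ.coe_lt
  simp only [IsInfinitesimal, hn, Metric.nhds_basis_ball_inv_nat_succ.tendsto_right_iff,
    Metric.mem_ball, dist_zero_right, forall_const]

theorem coe_mem_monad {x : I → Vec d} {X : Set (Vec d)} :
    (x : Star U (Vec d)) ∈ monad U X ↔ ∃ x₀ ∈ X, Tendsto x U (nhds x₀) := by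
  refine exists_congr fun x₀ => and_congr_right fun _ => ?_
  rw [← tendsto_sub_nhds_zero_iff]
  exact isInfinitesimal_coe

section Rep

variable (ρ : PosInfinitesimal U)

theorem PosInfinitesimal.exists_rep : ∃ r : I → ℝ,
    ρ.1 = (r : Star U ℝ) ∧ (∀ i, 0 < r i ∧ r i ≤ 1 / 2) ∧ Tendsto r U (nhds 0) := by
  obtain ⟨s, hs⟩ : ∃ s : I → ℝ, (s : Star U ℝ) = ρ.1 := Quotient.exists_rep ρ.1
  obtain ⟨hpos, hinf⟩ := ρ.2
  rw [← hs] at hpos hinf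
  have htendsto : Tendsto s U (nhds 0) := isInfinitesimal_coe.1 hinf
  have hs' : ∀ᶠ i in (U : Filter I), 0 < s i ∧ s i ≤ 1 / 2 :=
    (Germ.coe_lt.1 hpos).and (htendsto.eventually_le_const one_half_pos)
  have heq : ∀ᶠ i in (U : Filter I), s i = if 0 < s i ∧ s i ≤ 1 / 2 then s i else 1 / 2 :=
    hs'.mono fun i hi => (if_pos hi).symm
  refine ⟨fun i => if 0 < s i ∧ s i ≤ 1 / 2 then s i else 1 / 2, hs.symm.trans (Germ.coe_eq.2 heq),
    fun i => ?_, htendsto.congr' heq⟩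
  beta_reduce
  split_ifs with hi
  exacts [hi, ⟨one_half_pos, le_rfl⟩]

/-- A representative of a positive infinitesimal with values in `(0, 1/2]`. -/
def PosInfinitesimal.rep : I → ℝ := ρ.exists_rep.choose

theorem PosInfinitesimal.coe_rep : ρ.1 = (ρ.rep : Star U ℝ) := ρ.exists_rep.choose_spec.1

theorem PosInfinitesimal.rep_pos (i : I) : 0 < ρ.rep i := (ρ.exists_rep.choose_spec.2.1 i).1

theorem PosInfinitesimal.rep_le_half (i : I) : ρ.rep i ≤ 1 / 2 :=
  (ρ.exists_rep.choose_spec.2.1 i).2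

theorem PosInfinitesimal.tendsto_rep : Tendsto ρ.rep U (nhds 0) := ρ.exists_rep.choose_spec.2.2

theorem PosInfinitesimal.eventually_rep_le {ε : ℝ} (hε : 0 < ε) :
    ∀ᶠ i in (U : Filter I), ρ.rep i ≤ ε :=
  ρ.tendsto_rep.eventually_le_const hε

theorem PosInfinitesimal.eventually_le_inv_rep (C : ℝ) :
    ∀ᶠ i in (U : Filter I), C ≤ (ρ.rep i)⁻¹ :=
  (tendsto_inv_nhdsGT_zero.comp (tendsto_nhdsWithin_iff.2
    ⟨ρ.tendsto_rep, .of_forall ρ.rep_pos⟩)).eventually_ge_atTop C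

theorem PosInfinitesimal.eventually_le_mollifierOrder (n : ℕ) :
    ∀ᶠ i in (U : Filter I), n ≤ mollifierOrder (ρ.rep i) :=
  (ρ.eventually_le_inv_rep _).mono fun _ hi => le_mollifierOrder hi

theorem PosInfinitesimal.eq_zero_of_eventually_norm_le {E : Type*} [NormedAddCommGroup E] {z : E}
    (C : ℝ) (h : ∀ᶠ i in (U : Filter I), ‖z‖ ≤ C * ρ.rep i) : z = 0 := by
  have htendsto : Tendsto (fun i => C * ρ.rep i) U (nhds 0) := by
    simpa only [mul_zero] using ρ.tendsto_rep.const_mul C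
  exact norm_le_zero_iff.1 (ge_of_tendsto htendsto h)

theorem coe_mem_moderateNum {z : I → ℂ} : (z : Star U ℂ) ∈ ModerateNum ρ ↔
    ∃ n : ℕ, ∀ᶠ i in (U : Filter I), ‖z i‖ ≤ (ρ.rep i)⁻¹ ^ n := by
  rw [ModerateNum, Set.mem_ofPred_eq, ρ.coe_rep]
  rfl

theorem coe_mem_negligibleNum {z : I → ℂ} : (z : Star U ℂ) ∈ NegligibleNum ρ ↔
    ∀ n : ℕ, ∀ᶠ i in (U : Filter I), ‖z i‖ ≤ ρ.rep i ^ n := by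
  rw [NegligibleNum, Set.mem_ofPred_eq, ρ.coe_rep]
  rfl

theorem coe_mem_moderateNum_of_le {z : I → ℂ} (C : ℝ) (n : ℕ)
    (h : ∀ᶠ i in (U : Filter I), ‖z i‖ ≤ C * (ρ.rep i)⁻¹ ^ n) :
    (z : Star U ℂ) ∈ ModerateNum ρ := by
  refine (coe_mem_moderateNum ρ).2 ⟨n + 1, ?_⟩
  filter_upwards [h, ρ.eventually_le_inv_rep C] with i hz hC
  have hr := ρ.rep_pos i
  calc ‖z i‖ ≤ C * (ρ.rep i)⁻¹ ^ n := hz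
    _ ≤ (ρ.rep i)⁻¹ * (ρ.rep i)⁻¹ ^ n := by gcongr
    _ = (ρ.rep i)⁻¹ ^ (n + 1) := (pow_succ' _ _).symm

theorem coe_mem_negligibleNum_of_le {z : I → ℂ}
    (h : ∀ n : ℕ, ∃ C : ℝ, ∀ᶠ i in (U : Filter I), ‖z i‖ ≤ C * ρ.rep i ^ n) :
    (z : Star U ℂ) ∈ NegligibleNum ρ := by
  refine (coe_mem_negligibleNum ρ).2 fun n => ?_
  obtain ⟨C, hz⟩ := h (n + 1)
  filter_upwards [hz, ρ.eventually_le_inv_rep C] with i hz hC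
  have hr := ρ.rep_pos i
  calc ‖z i‖ ≤ C * ρ.rep i ^ (n + 1) := hz
    _ ≤ (ρ.rep i)⁻¹ * ρ.rep i ^ (n + 1) := by gcongr
    _ = ρ.rep i ^ n := by rw [pow_succ', inv_mul_cancel_left₀ hr.ne']

end Rep

theorem eval_of (F : I → Smooth Ω) (x : I → Vec d) : eval (StarE.of U F) (x : Star U (Vec d)) =
    ((fun i => extZero (F i).1 (x i) : I → ℂ) : Star U ℂ) :=
  rfl

theorem eval_sub (f g : StarE U Ω) {x : Star U (Vec d)} (hx : x ∈ starSet U (Ω : Set (Vec d))) :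
    eval (f - g) x = eval f x - eval g x := by
  rw [eq_sub_iff_add_eq, ← eval_add _ _ hx, sub_add_cancel]

theorem starPderiv_of (j : Fin d) (F : I → Smooth Ω) :
    starPderiv j (StarE.of U F) = StarE.of U fun i => Smooth.pderiv j (F i) := rfl

theorem multiDeriv_of (α : Fin d → ℕ) (F : I → Smooth Ω) : multiDeriv starPderiv α (StarE.of U F) =
    StarE.of U fun i => multiDeriv Smooth.pderiv α (F i) := by
  induction α using multiIndex_induction with
  | h0 => simp only [multiDeriv_zero, Module.End.one_apply]
  | hs α j ih =>
    simp only [multiDeriv_add_single _ starPderiv_commute,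
      multiDeriv_add_single _ Smooth.pderiv_commute, Module.End.mul_apply, ih, starPderiv_of]

theorem IsNegligible.eval_mem {ρ : PosInfinitesimal U} {f : StarE U Ω} (hf : IsNegligible ρ f)
    {x : Star U (Vec d)} (hx : x ∈ monad U (Ω : Set (Vec d))) : eval f x ∈ NegligibleNum ρ := by
  simpa only [multiDeriv_zero, Module.End.one_apply] using hf 0 x hx

/-! ### Locally equal families of functions -/

/-- Near every point of `Ω`, almost all the functions `F i` and `G i` coincide on a neighbourhood
that does not depend on `i`; this makes the classes of `F` and `G` equal in `^ρE(Ω)`. -/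
def LocEq (U : Ultrafilter I) (F G : I → Smooth Ω) : Prop :=
  ∀ x₀ ∈ Ω, ∀ᶠ z in (U : Filter I) ×ˢ nhds x₀, extZero (F z.1).1 z.2 = extZero (G z.1).1 z.2

namespace LocEq

variable {F G : I → Smooth Ω}

theorem pderiv (h : LocEq U F G) (j : Fin d) :
    LocEq U (fun i => Smooth.pderiv j (F i)) fun i => Smooth.pderiv j (G i) := by
  intro x₀ hx₀
  obtain ⟨A, hA, B, hB, hAB⟩ := eventually_prod_iff.1 (h x₀ hx₀)
  filter_upwards [hA.prod_mk (hB.eventually_nhds.and (Ω.isOpen.mem_nhds hx₀))] with z hz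
  obtain ⟨hAz, hBz, hzΩ⟩ := hz
  have heq : extZero (F z.1).1 =ᶠ[nhds z.2] extZero (G z.1).1 := hBz.mono fun _ => hAB hAz
  rw [extZero_mem _ hzΩ, extZero_mem _ hzΩ, Smooth.pderiv_apply, Smooth.pderiv_apply,
    heq.fderiv_eq]

theorem multiDeriv (h : LocEq U F G) (α : Fin d → ℕ) :
    LocEq U (fun i => multiDeriv Smooth.pderiv α (F i)) fun i =>
      RhoAsymptotic.multiDeriv Smooth.pderiv α (G i) := by
  induction α using multiIndex_induction with
  | h0 => simpa only [multiDeriv_zero, Module.End.one_apply] using h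
  | hs α j ih =>
    simp only [multiDeriv_add_single _ Smooth.pderiv_commute, Module.End.mul_apply]
    exact ih.pderiv j

theorem eval_multiDeriv (h : LocEq U F G) (α : Fin d → ℕ) {x : Star U (Vec d)}
    (hx : x ∈ monad U (Ω : Set (Vec d))) :
    eval (RhoAsymptotic.multiDeriv starPderiv α (StarE.of U F)) x =
      eval (RhoAsymptotic.multiDeriv starPderiv α (StarE.of U G)) x := by
  induction x using Germ.inductionOn with | _ x =>
  obtain ⟨x₀, hx₀, hx⟩ := coe_mem_monad.1 hx
  rw [multiDeriv_of, multiDeriv_of, eval_of, eval_of]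
  exact Germ.coe_eq.2 ((tendsto_id.prodMk hx).eventually (h.multiDeriv α x₀ hx₀))

theorem isNegligible_sub (ρ : PosInfinitesimal U) (h : LocEq U F G) :
    IsNegligible ρ (StarE.of U F - StarE.of U G) := by
  intro α x hx
  rw [map_sub, eval_sub _ _ (monad_subset_starSet Ω hx), h.eval_multiDeriv α hx, sub_self]
  exact NegligibleNum.zero ρ

end LocEq

/-! ### The cut-off functions -/

open Classical in
/-- A cut-off function for `Ω` at scale `r`: it equals `1` at the points of norm at most `r⁻¹` that
are at distance at least `3 * r` from the complement of `Ω`, and its support keeps distance `r` from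
the boundary. It is `0` for `r ≤ 0`. -/
def cutoff (Ω : Opens (Vec d)) (r : ℝ) : 𝓓(Ω, ℂ) :=
  if hr : 0 < r then (exists_cutoff Ω hr).choose else 0

theorem cutoff_eq_one {r : ℝ} (hr : 0 < r) {x : Vec d} (hx : ‖x‖ ≤ r⁻¹)
    (h : ∀ y ∉ Ω, 3 * r ≤ dist x y) : cutoff Ω r x = 1 := by
  rw [cutoff, dif_pos hr]
  exact (exists_cutoff Ω hr).choose_spec.1 x hx h

theorem le_norm_sub_of_mem_tsupport_cutoff {r : ℝ} (hr : 0 < r) {x y : Vec d}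
    (hx : x ∈ tsupport (cutoff Ω r)) (hy : y ∈ frontier (Ω : Set (Vec d))) : r ≤ ‖x - y‖ := by
  rw [cutoff, dif_pos hr] at hx
  exact (exists_cutoff Ω hr).choose_spec.2 x hx y hy

variable (ρ : PosInfinitesimal U)

theorem eventually_cutoff_eq_one {K : Set (Vec d)} (hK : IsCompact K) (h : K ⊆ Ω) :
    ∀ᶠ i in (U : Filter I), ∀ x ∈ K, cutoff Ω (ρ.rep i) x = 1 := by
  obtain ⟨δ, hδ, hdist⟩ := exists_forall_norm_le_inv_and_le_dist hK h
  filter_upwards [ρ.eventually_rep_le hδ] with i hi x hx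
  obtain ⟨hnorm, hcompl⟩ := hdist _ (ρ.rep_pos i) hi x hx
  exact cutoff_eq_one (ρ.rep_pos i) hnorm hcompl

theorem eventually_isOneNear_cutoff {x₀ : Vec d} (h : x₀ ∈ Ω) :
    ∀ᶠ z in (U : Filter I) ×ˢ nhds x₀,
      z.2 ∈ Ω ∧ IsOneNear (cutoff Ω (ρ.rep z.1)) z.2 (2 * ρ.rep z.1) := by
  obtain ⟨ε, hε, hball⟩ := Metric.nhds_basis_closedBall.mem_iff.1 (Ω.isOpen.mem_nhds h)
  filter_upwards [((eventually_cutoff_eq_one ρ (isCompact_closedBall x₀ ε) hball).and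
    (ρ.eventually_rep_le (ε := ε / 4) (by positivity))).prod_mk
      (Metric.ball_mem_nhds x₀ (half_pos hε))] with z ⟨⟨hone, hr⟩, hz⟩
  refine ⟨hball (Metric.mem_closedBall.2 (by linarith)), fun ξ hξ => hone ξ ?_⟩
  rw [Metric.mem_ball] at hξ
  rw [Metric.mem_closedBall]
  linarith [dist_triangle ξ z.2 x₀]

theorem eventually_isOneNear_cutoff_of_tendsto {x₀ : Vec d} (h : x₀ ∈ Ω) {x : I → Vec d}
    (hx : Tendsto x U (nhds x₀)) : ∀ᶠ i in (U : Filter I),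
      x i ∈ Ω ∧ IsOneNear (cutoff Ω (ρ.rep i)) (x i) (2 * ρ.rep i) :=
  (tendsto_id.prodMk hx).eventually (eventually_isOneNear_cutoff ρ h)

/-- The `ρ`-cut-off function `Π_Ω` of the embedding. -/
def starCutoff (Ω : Opens (Vec d)) : Star U 𝓓(Ω, ℂ) :=
  ((fun i => cutoff Ω (ρ.rep i) : I → 𝓓(Ω, ℂ)) : Star U 𝓓(Ω, ℂ))

theorem isRhoCutoff_starCutoff (Ω : Opens (Vec d)) : IsRhoCutoff ρ (starCutoff ρ Ω) where
  eq_one x hx := by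
    induction x using Germ.inductionOn with | _ x =>
    obtain ⟨x₀, hx₀, hx⟩ := coe_mem_monad.1 hx
    refine Germ.coe_eq.2 ((eventually_isOneNear_cutoff_of_tendsto ρ hx₀ hx).mono fun i hi => ?_)
    exact hi.2 (x i) (Metric.mem_ball_self (mul_pos two_pos (ρ.rep_pos i)))
  support x hx y hy := by
    induction x using Germ.inductionOn with | _ x =>
    induction y using Germ.inductionOn with | _ y =>
    have hx : ∀ᶠ i in (U : Filter I), x i ∈ tsupport (cutoff Ω (ρ.rep i)) := hx
    have hy : ∀ᶠ i in (U : Filter I), y i ∈ frontier (Ω : Set (Vec d)) := hy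
    rw [ρ.coe_rep]
    exact Germ.coe_le.2 ((hx.and hy).mono fun i hi =>
      le_norm_sub_of_mem_tsupport_cutoff (ρ.rep_pos i) hi.1 hi.2)

/-! ### The delta function -/

theorem setIntegral_delta_mul_homogeneous {r : ℝ} (hr : 0 < r) {j : ℕ}
    (hj : j ≤ mollifierOrder r) {g : Vec d → ℂ} (hg : Continuous g)
    (hhom : ∀ (t : ℝ) y, g (t • y) = t ^ j • g y) :
    ∫ x in Metric.closedBall (0 : Vec d) r, extZero (delta d r).1 x * g x =
      0 ^ j * ∫ y, bump d y • g y := by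
  rw [setIntegral_closedBall_mul_eq_integral (vanishesOff_delta d hr) le_rfl, extZero_delta,
    integral_mollifier_mul_homogeneous hj hr hg hhom]

theorem setIntegral_delta {r : ℝ} (hr : 0 < r) :
    ∫ x in Metric.closedBall (0 : Vec d) r, extZero (delta d r).1 x = 1 := by
  have h := setIntegral_delta_mul_homogeneous hr (Nat.zero_le _) (g := fun _ : Vec d => 1)
    continuous_const (by simp)
  rwa [integral_smul_const, integral_bump, one_smul, pow_zero, mul_one,
    integral_congr_ae (.of_forall fun _ => mul_one _)] at h

theorem setIntegral_delta_mul_monomial {r : ℝ} (hr : 0 < r) {α : Fin d → ℕ} (hα : α ≠ 0)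
    (ho : ∑ i, α i ≤ mollifierOrder r) :
    ∫ x in Metric.closedBall (0 : Vec d) r, extZero (delta d r).1 x * ∏ i, (x i : ℂ) ^ α i = 0 := by
  have hsum : ∑ i, α i ≠ 0 := fun h => hα (funext fun i => Finset.sum_eq_zero_iff.1 h i (by simp))
  rw [setIntegral_delta_mul_homogeneous hr ho (by fun_prop) fun t y => ?_, zero_pow hsum, zero_mul]
  simp [mul_pow, Finset.prod_mul_distrib, Finset.prod_pow_eq_pow_sum]

theorem norm_iteratedFDeriv_extZero_pderiv_le (f : Smooth (⊤ : Opens (Vec d))) (j : Fin d) (n : ℕ)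
    (x : Vec d) : ‖iteratedFDeriv ℝ n (extZero (Smooth.pderiv j f).1) x‖ ≤
      ‖iteratedFDeriv ℝ (n + 1) (extZero f.1) x‖ := by
  have hpderiv : extZero (Smooth.pderiv j f).1 = fun x => fderiv ℝ (extZero f.1) x (unitVec j) :=
    funext (extZero_pderiv_top f j)
  have hfderiv : ContDiff ℝ ∞ (fderiv ℝ (extZero f.1)) :=
    (contDiff_extZero_top f).fderiv_right (by simp)
  rw [hpderiv, ← norm_iteratedFDeriv_fderiv]
  refine (norm_iteratedFDeriv_clm_apply_const hfderiv.contDiffAt (mod_cast le_top)).trans ?_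
  exact mul_le_of_le_one_left (norm_nonneg _) (by simp [unitVec])

theorem exists_norm_extZero_multiDeriv_le (α : Fin d → ℕ) : ∃ n : ℕ,
    ∀ (f : Smooth (⊤ : Opens (Vec d))) (B : ℝ), (∀ y, ‖iteratedFDeriv ℝ n (extZero f.1) y‖ ≤ B) →
      ∀ x, ‖extZero (multiDeriv Smooth.pderiv α f).1 x‖ ≤ B := by
  induction α using multiIndex_induction with
  | h0 =>
    refine ⟨0, fun f B h x => ?_⟩
    simpa only [multiDeriv_zero, Module.End.one_apply, norm_iteratedFDeriv_zero] using h x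
  | hs α j ih =>
    obtain ⟨n, hn⟩ := ih
    refine ⟨n + 1, fun f B h x => ?_⟩
    rw [multiDeriv_add_single _ Smooth.pderiv_commute,
      (commute_multiDeriv _ Smooth.pderiv_commute α j).eq, Module.End.mul_apply]
    exact hn _ B (fun y => (norm_iteratedFDeriv_extZero_pderiv_le f j n y).trans (h y)) x

/-- The `ρ`-delta function `D` of the embedding. -/
def starDelta (d : ℕ) : StarE U (⊤ : Opens (Vec d)) := StarE.of U fun i => delta d (ρ.rep i)

theorem isModerate_starDelta : IsModerate ρ (starDelta ρ d) := by
  intro α x _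
  induction x using Germ.inductionOn with | _ x =>
  obtain ⟨n, hn⟩ := exists_norm_extZero_multiDeriv_le α
  obtain ⟨M, -, hM⟩ := exists_norm_iteratedFDeriv_delta_le d n
  rw [starDelta, multiDeriv_of, eval_of]
  exact coe_mem_moderateNum_of_le ρ M _ (.of_forall fun i =>
    hn _ _ (hM _ (ρ.rep_pos i) (ρ.rep_le_half i)) _)

theorem isRhoDelta_starDelta : IsRhoDelta ρ (starDelta ρ d) where
  eq_zero x hx := by
    induction x using Germ.inductionOn with | _ x =>
    rw [ρ.coe_rep] at hx
    exact Germ.coe_eq.2 ((Germ.coe_le.1 hx).mono fun i hi => vanishesOff_delta d (ρ.rep_pos i) _ hi)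
  integral := by
    have hintegral : Germ.map₂ (fun (f : Smooth (⊤ : Opens (Vec d))) (r : ℝ) =>
        ∫ x in Metric.closedBall (0 : Vec d) r, extZero f.1 x) (starDelta ρ d)
          (ρ.rep : Star U ℝ) = 1 :=
      Germ.coe_eq.2 (.of_forall fun i => setIntegral_delta (ρ.rep_pos i))
    rw [ρ.coe_rep, hintegral, sub_self]
    exact NegligibleNum.zero ρ
  moment α hα := by
    have hmoment : Germ.map₂ (fun (f : Smooth (⊤ : Opens (Vec d))) (r : ℝ) =>
        ∫ x in Metric.closedBall (0 : Vec d) r, extZero f.1 x * ∏ i, (x i : ℂ) ^ α i)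
          (starDelta ρ d) (ρ.rep : Star U ℝ) = 0 :=
      Germ.coe_eq.2 ((ρ.eventually_le_mollifierOrder (∑ i, α i)).mono fun i hi =>
        setIntegral_delta_mul_monomial (ρ.rep_pos i) hα hi)
    rw [ρ.coe_rep, hmoment]
    exact NegligibleNum.zero ρ
  moderate := isModerate_starDelta ρ

/-! ### The embedding -/

/-- The family of the convolutions of `T`, cut off, with the members of the delta net. -/
def regNet (T : Distr Ω) (i : I) : Smooth Ω :=
  regularize T (cutoff Ω (ρ.rep i)) (delta d (ρ.rep i))

/-- The convolution `(*T Π_Ω) ⋆ D`. -/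
def starReg (T : Distr Ω) : StarE U Ω := StarE.of U (regNet ρ T)

theorem extZero_regNet (T : Distr Ω) (i : I) {x : Vec d} (hx : x ∈ Ω) :
    extZero (regNet ρ T i).1 x = T (cutTranslate (cutoff Ω (ρ.rep i)) (delta d (ρ.rep i)) x) :=
  extZero_regularize T _ _ hx

theorem isConvolution_starReg (T : Distr Ω) :
    IsConvolution T (starCutoff ρ Ω) (starDelta ρ d) (starReg ρ T) := by
  intro x hx
  induction x using Germ.inductionOn with | _ x =>
  have hx : ∀ᶠ i in (U : Filter I), x i ∈ Ω := hx
  exact Germ.coe_eq.2 (hx.mono fun i => extZero_regNet ρ T i)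

theorem locEq_pderiv_regNet (j : Fin d) (T : Distr Ω) :
    LocEq U (fun i => Smooth.pderiv j (regNet ρ T i)) (regNet ρ (Distr.pderiv j T)) := by
  intro x₀ hx₀
  filter_upwards [eventually_isOneNear_cutoff ρ hx₀] with ⟨i, x⟩ ⟨hx, hone⟩
  have hr := ρ.rep_pos i
  rw [regNet, pderiv_regularize, extZero_regularize _ _ _ hx, extZero_regNet _ _ _ hx,
    pderiv_apply_cutTranslate T (by linarith) hone (vanishesOff_delta d hr)]

theorem locEq_restrict_regNet {O : Opens (Vec d)} (h : O ≤ Ω) (T : Distr Ω) :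
    LocEq U (fun i => Smooth.restrict h (regNet ρ T i)) (regNet ρ (Distr.restrict h T)) := by
  intro x₀ hx₀
  filter_upwards [eventually_isOneNear_cutoff ρ hx₀, eventually_isOneNear_cutoff ρ (h hx₀)]
    with ⟨i, x⟩ ⟨hxO, honeO⟩ ⟨hx, hone⟩
  have hr := ρ.rep_pos i
  have hr2 : ρ.rep i ≤ 2 * ρ.rep i := by linarith
  rw [Smooth.extZero_restrict h _ hxO, extZero_regNet _ _ _ hx, extZero_regNet _ _ _ hxO,
    restrict_apply_cutTranslate h T (hone.mono hr2) (honeO.mono hr2) (vanishesOff_delta d hr)]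

theorem eval_multiDeriv_starReg (T : Distr Ω) (α : Fin d → ℕ) (j : Fin d) {x : Star U (Vec d)}
    (hx : x ∈ monad U (Ω : Set (Vec d))) :
    eval (multiDeriv starPderiv (α + Pi.single j 1) (starReg ρ T)) x =
      eval (multiDeriv starPderiv α (starReg ρ (Distr.pderiv j T))) x := by
  rw [multiDeriv_starPderiv, starReg, starPderiv_of,
    (locEq_pderiv_regNet ρ j T).eval_multiDeriv α hx, starReg]

theorem eval_starReg_mem_moderateNum (T : Distr Ω) {x : Star U (Vec d)}
    (hx : x ∈ monad U (Ω : Set (Vec d))) : eval (starReg ρ T) x ∈ ModerateNum ρ := by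
  induction x using Germ.inductionOn with | _ x =>
  obtain ⟨x₀, hx₀, hx⟩ := coe_mem_monad.1 hx
  obtain ⟨ε, hε, hball⟩ := Metric.nhds_basis_closedBall.mem_iff.1 (Ω.isOpen.mem_nhds hx₀)
  obtain ⟨n, C, hC⟩ := exists_norm_apply_cutTranslate_delta_le T hball
  rw [starReg, eval_of]
  refine coe_mem_moderateNum_of_le ρ C n ?_
  filter_upwards [eventually_isOneNear_cutoff_of_tendsto ρ hx₀ hx,
    ρ.eventually_rep_le (half_pos hε), hx.eventually (Metric.ball_mem_nhds x₀ (half_pos hε))]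
    with i ⟨hxΩ, hone⟩ hrε hxε
  have hr := ρ.rep_pos i
  rw [extZero_regNet _ _ _ hxΩ]
  exact hC _ _ _ hr (ρ.rep_le_half i) hrε hxε (hone.mono (by linarith))

theorem isModerate_starReg (T : Distr Ω) : IsModerate ρ (starReg ρ T) := by
  intro α x hx
  induction α using multiIndex_induction generalizing T with
  | h0 =>
    rw [multiDeriv_zero, Module.End.one_apply]
    exact eval_starReg_mem_moderateNum ρ T hx
  | hs α j ih =>
    rw [eval_multiDeriv_starReg ρ T α j hx]
    exact ih _

/-- The embedding `Σ_Ω : D'(Ω) → ^ρE(Ω)`. -/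
def embed (Ω : Opens (Vec d)) : Distr Ω →ₗ[ℂ] RhoE ρ Ω where
  toFun T := RhoE.mk ρ (starReg ρ T) (isModerate_starReg ρ T)
  map_add' _ _ := rfl
  map_smul' _ _ := rfl

theorem embed_apply (T : Distr Ω) :
    embed ρ Ω T = RhoE.mk ρ (starReg ρ T) (isModerate_starReg ρ T) := rfl

theorem embed_pderiv (j : Fin d) (T : Distr Ω) :
    embed ρ Ω (Distr.pderiv j T) = RhoE.pderiv j (embed ρ Ω T) := by
  rw [embed_apply, embed_apply, RhoE.pderiv_mk]
  exact (RhoE.mk_eq_mk.2 ((locEq_pderiv_regNet ρ j T).isNegligible_sub ρ)).symm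

theorem embed_restrict {O : Opens (Vec d)} (h : O ≤ Ω) (T : Distr Ω) :
    embed ρ O (Distr.restrict h T) = RhoE.restrict ρ h (embed ρ Ω T) := by
  rw [embed_apply, embed_apply, RhoE.restrict_mk]
  exact (RhoE.mk_eq_mk.2 ((locEq_restrict_regNet ρ h T).isNegligible_sub ρ)).symm

/-! ### Smooth functions -/

theorem eval_starReg_ofSmooth_sub_mem_negligibleNum (f : Smooth Ω) {x : Star U (Vec d)}
    (hx : x ∈ monad U (Ω : Set (Vec d))) :
    eval (starReg ρ (Distr.ofSmooth f)) x - eval (StarE.standard U f) x ∈ NegligibleNum ρ := by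
  induction x using Germ.inductionOn with | _ x =>
  obtain ⟨x₀, hx₀, hx⟩ := coe_mem_monad.1 hx
  obtain ⟨ε, hε, hball⟩ := Metric.nhds_basis_closedBall.mem_iff.1 (Ω.isOpen.mem_nhds hx₀)
  have hε4 : 0 < ε / 4 := by positivity
  refine coe_mem_negligibleNum_of_le ρ (z := fun i =>
    extZero (regNet ρ (Distr.ofSmooth f) i).1 (x i) - extZero f.1 (x i)) fun n => ?_
  obtain ⟨C, hC⟩ := exists_norm_ofSmooth_apply_cutTranslate_delta_sub_le f hε hball n
  refine ⟨C, ?_⟩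
  filter_upwards [eventually_isOneNear_cutoff_of_tendsto ρ hx₀ hx, ρ.eventually_rep_le hε4,
    hx.eventually (Metric.ball_mem_nhds x₀ hε4), ρ.eventually_le_mollifierOrder n]
    with i ⟨hxΩ, hone⟩ hrε hxε hn
  have hr := ρ.rep_pos i
  rw [extZero_regNet _ _ _ hxΩ]
  exact hC _ _ _ hr (ρ.rep_le_half i) hn hrε hxε (hone.mono (by linarith))

theorem isNegligible_starReg_ofSmooth_sub (f : Smooth Ω) :
    IsNegligible ρ (starReg ρ (Distr.ofSmooth f) - StarE.standard U f) := by
  intro α x hx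
  rw [map_sub, eval_sub _ _ (monad_subset_starSet Ω hx)]
  induction α using multiIndex_induction generalizing f with
  | h0 =>
    simp only [multiDeriv_zero, Module.End.one_apply]
    exact eval_starReg_ofSmooth_sub_mem_negligibleNum ρ f hx
  | hs α j ih =>
    rw [eval_multiDeriv_starReg ρ _ α j hx, pderiv_ofSmooth, multiDeriv_starPderiv]
    exact ih (Smooth.pderiv j f)

theorem embed_ofSmooth (f : Smooth Ω) : embed ρ Ω (Distr.ofSmooth f) = RhoE.ofSmooth ρ f :=
  RhoE.mk_eq_mk.2 (isNegligible_starReg_ofSmooth_sub ρ f)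

theorem embed_ofSmooth_mul (f g : Smooth Ω) :
    embed ρ Ω (Distr.ofSmooth f) * embed ρ Ω (Distr.ofSmooth g) =
      embed ρ Ω (Distr.ofSmooth (f * g)) := by
  simp only [embed_ofSmooth, map_mul]

/-! ### Injectivity -/

theorem IsNegligible.eventually_norm_le {F : I → Smooth Ω} (h : IsNegligible ρ (StarE.of U F))
    {K : Set (Vec d)} (hK : IsCompact K) (hKΩ : K ⊆ Ω) :
    ∀ᶠ i in (U : Filter I), ∀ x ∈ K, ‖extZero (F i).1 x‖ ≤ ρ.rep i := by
  by_contra hn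
  have hlt : ∀ᶠ i in (U : Filter I), ∃ x ∈ K, ρ.rep i < ‖extZero (F i).1 x‖ := by
    rw [← Ultrafilter.frequently_iff_eventually, not_frequently] at hn
    simpa only [not_forall, not_le, exists_prop] using hn
  -- A family of points of `K` violating the bound is a point of `*K`, which lies in `μ(Ω)`.
  obtain ⟨x, hx⟩ := hlt.choice
  obtain ⟨x₀, hx₀, htendsto⟩ := hK.ultrafilter_le_nhds (U.map x)
    (le_principal_iff.2 (hx.mono fun i hi => hi.1))
  have heval := h.eval_mem (coe_mem_monad.2 ⟨x₀, hKΩ hx₀, htendsto⟩)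
  rw [eval_of] at heval
  obtain ⟨i, hle, -, hlt⟩ := (((coe_mem_negligibleNum ρ).1 heval 1).and hx).exists
  rw [pow_one] at hle
  exact hle.not_gt hlt

theorem eq_zero_of_isNegligible_starReg {T : Distr Ω} (h : IsNegligible ρ (starReg ρ T)) :
    T = 0 := by
  ext φ
  change T φ = 0
  have hK : IsCompact (tsupport φ) := φ.hasCompactSupport
  obtain ⟨ε, hε, hεΩ⟩ := hK.exists_cthickening_subset_open Ω.isOpen φ.tsupport_subset
  obtain ⟨C, hC⟩ := exists_norm_integral_mul_apply_cutTranslate_delta_sub_le T φ hε hεΩ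
  obtain ⟨B, hB⟩ := φ.hasCompactSupport.exists_bound_of_continuous φ.contDiff.continuous
  have hB0 : 0 ≤ B := (norm_nonneg _).trans (hB 0)
  refine ρ.eq_zero_of_eventually_norm_le (C + B * volume.real (tsupport φ)) ?_
  filter_upwards [h.eventually_norm_le ρ hK φ.tsupport_subset, ρ.eventually_le_mollifierOrder 1,
    ρ.eventually_rep_le (half_pos hε), eventually_cutoff_eq_one ρ hK.cthickening hεΩ]
    with i hsmall hord hrε hone
  set pairing := ∫ x in tsupport φ,
    φ x * T (cutTranslate (cutoff Ω (ρ.rep i)) (delta d (ρ.rep i)) x)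
  have hlim : ‖pairing - T φ‖ ≤ C * ρ.rep i :=
    hC _ _ (ρ.rep_pos i) (ρ.rep_le_half i) hord hrε hone
  have hpairing : ‖pairing‖ ≤ B * ρ.rep i * volume.real (tsupport φ) :=
    norm_setIntegral_le_of_norm_le_const hK.measure_lt_top fun x hx => by
      rw [norm_mul, ← extZero_regNet _ _ _ (φ.tsupport_subset hx)]
      exact mul_le_mul (hB x) (hsmall x hx) (norm_nonneg _) hB0
  calc ‖T φ‖ ≤ ‖pairing‖ + ‖pairing - T φ‖ := norm_le_insert _ _
    _ ≤ B * ρ.rep i * volume.real (tsupport φ) + C * ρ.rep i := add_le_add hpairing hlim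
    _ = (C + B * volume.real (tsupport φ)) * ρ.rep i := by ring

theorem embed_injective (Ω : Opens (Vec d)) : Function.Injective (embed ρ Ω) := by
  refine (injective_iff_map_eq_zero _).2 fun T hT => eq_zero_of_isNegligible_starReg ρ ?_
  have hneg : IsNegligible ρ (starReg ρ T - 0) :=
    RhoE.mk_eq_mk (hg := (Moderate ρ Ω).zero_mem).1 hT
  rwa [sub_zero] at hneg

end Nonstandard

end

end RhoAsymptotic

open RhoAsymptotic in
theorem mainTheorem12 {I : Type*} (U : Ultrafilter I) (hU : CountablyIncomplete U) (d : ℕ)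
    (ρ : PosInfinitesimal U) :
    ∃ (D : StarE U (⊤ : Opens (Vec d)))
      (P : ∀ Ω : Opens (Vec d), Star U 𝓓(Ω, ℂ))
      (σ : ∀ Ω : Opens (Vec d), Distr Ω →ₗ[ℂ] RhoE ρ Ω),
      -- `D` is a `ρ`-delta function and every `P Ω` is a `ρ`-cut-off function for `Ω`
      IsRhoDelta ρ D ∧ (∀ Ω, IsRhoCutoff ρ (P Ω)) ∧
      -- `σ Ω T` is the class of `(*T Π_Ω) ⋆ D`
      (∀ Ω (T : Distr Ω), ∃ (F : StarE U Ω) (hF : IsModerate ρ F),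
        IsConvolution T (P Ω) D F ∧ σ Ω T = RhoE.mk ρ F hF) ∧
      -- `E(Ω) → D'(Ω) → ^ρE(Ω)` are embeddings
      (∀ Ω, Function.Injective (Distr.ofSmooth (Ω := Ω)) ∧ Function.Injective (σ Ω)) ∧
      -- `σ Ω` preserves partial differentiation
      (∀ Ω (α : Fin d → ℕ) (T : Distr Ω),
        σ Ω (multiDeriv Distr.pderiv α T) = multiDeriv RhoE.pderiv α (σ Ω T)) ∧
      -- `σ` is a morphism of sheaves, and preserves and reflects vanishing on open subsets
      (∀ (O Ω : Opens (Vec d)) (h : O ≤ Ω) (T : Distr Ω),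
        σ O (Distr.restrict h T) = RhoE.restrict ρ h (σ Ω T) ∧
        (RhoE.restrict ρ h (σ Ω T) = 0 ↔ Distr.restrict h T = 0)) ∧
      -- on smooth functions, `σ Ω` is `f ↦` the class of `*f`
      (∀ Ω (f : Smooth Ω), σ Ω (Distr.ofSmooth f) = RhoE.ofSmooth ρ f) ∧
      -- the product of `^ρE(Ω)` extends the pointwise product of `E(Ω)`
      (∀ Ω (f g : Smooth Ω),
        σ Ω (Distr.ofSmooth f) * σ Ω (Distr.ofSmooth g) = σ Ω (Distr.ofSmooth (f * g))) :=
  ⟨starDelta ρ d, starCutoff ρ, embed ρ, isRhoDelta_starDelta ρ, isRhoCutoff_starCutoff ρ,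
    fun _ T => ⟨starReg ρ T, isModerate_starReg ρ T, isConvolution_starReg ρ T, rfl⟩,
    fun Ω => ⟨Distr.ofSmooth_injective, embed_injective ρ Ω⟩,
    fun Ω α T => map_multiDeriv _ _ (embed ρ Ω) (embed_pderiv ρ) α T,
    fun O _ h T => ⟨embed_restrict ρ h T, by
      rw [← embed_restrict, map_eq_zero_iff _ (embed_injective ρ O)]⟩,
    fun _ f => embed_ofSmooth ρ f,
    fun _ f g => embed_ofSmooth_mul ρ f g⟩
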